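/- An and/or tree is a binary plane rooted tree whose internal nodes are labelled by $\land$ or $\lor$ and whose leaves are labelled by literals $x_i$ or $\bar x_i$; its size is its number of leaves. Two and/or trees are equivalent if they coincide once the leaf labels are removed, and two leaves carry the same variable (resp. the same literal) in the first tree if and only if the corresponding two leaves do in the second one. A tautology is an and/or tree that represents the constant Boolean function true. A simple tautology is an and/or tree that contains two leaves labelled by a variable $x$ and its negation $\bar x$ such that all internal nodes from the root to both these leaves are labelled by $\lor$. Let $\mathcal T$ be the family of tautologies and $\mathcal S$ the family of simple tautologies. Let $(k_n)_{n\ge 1}$ be a non-decreasing sequence of non-negative integers with $k_n\to\infty$. Consider the following two models. Model (G): $A_n$ is the number of and/or trees of size $n$ with leaf labels in $\{x_1,\bar x_1,\dots,x_{k_n},\bar x_{k_n}\}$; for a family $\mathcal G$ of and/or trees, $G_n$ is the number of those trees that belong to $\mathcal G$; and $\mathrm{Lab}_{n,m}=(2m)^n$. Model (E): $A_n$ is the number of equivalence classes of and/or trees of size $n$ that contain at least one tree with leaf labels in $\{x_1,\bar x_1,\dots,x_{k_n},\bar x_{k_n}\}$; for a family $\mathcal G$ of equivalence classes, $G_n$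 is the number of those classes that belong to $\mathcal G$ (here $\mathcal T$ and $\mathcal S$ stand for the families of equivalence classes of tautologies and of simple tautologies); and $\mathrm{Lab}_{n,m}=2^n\sum_{p=1}^m {n\brace p}2^{-p}$, where ${n\brace p}$ is the Stirling number of the second kind. In both models put $\mu_n(\mathcal G)=G_n/A_n$ and $\mathrm{rat}_n=\mathrm{Lab}_{n-1,k_n}/\mathrm{Lab}_{n,k_n}$. Then, in both models, as $n\to\infty$, $$\mu_n(\mathcal S)\sim \tfrac32\,\mathrm{rat}_n \qquad\text{and}\qquad \mu_n(\mathcal T)\sim\mu_n(\mathcal S).$$ -/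

import Mathlib

open Filter Asymptotics

/-- The labels of internal nodes: `conj` is the connective `∧`, `disj` is the connective `∨`. -/
inductive Connective : Type
  | conj
  | disj

/-- Binary plane trees whose internal nodes are labelled by connectives and whose leaves are
labelled by elements of `α`. -/
inductive ConnTree (α : Type) : Type
  | leaf (a : α) : ConnTree α
  | node (c : Connective) (l r : ConnTree α) : ConnTree α

namespace ConnTree

/-- The leaf labels, from left to right. -/
def leaves {α : Type} : ConnTree α → List α
  | leaf a => [a]
  | node _ l r => l.leaves ++ r.leaves

/-- The size of a tree is its number of leaves. -/
def size {α : Type} (t : ConnTree α) : ℕ := t.leaves.length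

/-- The tree-structure: the labels of the leaves (but not those of the internal nodes)
are removed. -/
def treeStructure {α : Type} : ConnTree α → ConnTree Unit
  | leaf _ => leaf ()
  | node c l r => node c l.treeStructure r.treeStructure

/-- The labels of those leaves for which all internal nodes on the path from the root to the leaf
are labelled by `∨`. -/
def orLeaves {α : Type} : ConnTree α → List α
  | leaf a => [a]
  | node .disj l r => l.orLeaves ++ r.orLeaves
  | node .conj _ _ => []

theorem size_treeStructure {α : Type} (t : ConnTree α) : t.treeStructure.size = t.size := by
  induction t with
  | leaf a => rfl
  | node c l r hl hr => simp_all [size, treeStructure, leaves]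

theorem size_eq_of_treeStructure_eq {α : Type} {s t : ConnTree α}
    (h : s.treeStructure = t.treeStructure) : s.size = t.size := by
  rw [← size_treeStructure s, h, size_treeStructure t]

end ConnTree

/-- A literal: the pair `(i, true)` is the positive literal `x_i`, the pair `(i, false)` is its
negation. The variables are `x_0, x_1, x_2, …`. -/
abbrev Literal : Type := ℕ × Bool

/-- And/or trees. -/
abbrev AndOrTree : Type := ConnTree Literal

namespace AndOrTree

/-- The value of the Boolean function represented by the tree at an assignment of the variables. -/
def eval (x : ℕ → Bool) : AndOrTree → Bool
  | .leaf (i, true) => x i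
  | .leaf (i, false) => !x i
  | .node .conj l r => eval x l && eval x r
  | .node .disj l r => eval x l || eval x r

/-- A tautology represents the constant function `true`. -/
def IsTautology (t : AndOrTree) : Prop := ∀ x : ℕ → Bool, eval x t = true

/-- A simple tautology has two leaves, labelled by a variable and by its negation, such that all
internal nodes from the root to both these leaves are labelled by `∨`. -/
def IsSimpleTautology (t : AndOrTree) : Prop :=
  ∃ i : ℕ, ((i, true) : Literal) ∈ t.orLeaves ∧ ((i, false) : Literal) ∈ t.orLeaves

/-- All leaf labels belong to the literals of the first `k` variables. -/
def UsesVars (k : ℕ) (t : AndOrTree) : Prop := ∀ a ∈ t.leaves, a.1 < k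

/-- Equivalence of and/or trees: the same tree-structure, and for any two positions of leaves,
these carry the same variable (resp. the same literal) in `s` if and only if they carry the same
variable (resp. the same literal) in `t`. -/
def Equivalent (s t : AndOrTree) : Prop :=
  s.treeStructure = t.treeStructure ∧
  (∀ i < s.size, ∀ j < s.size,
    ((s.leaves.map Prod.fst)[i]? = (s.leaves.map Prod.fst)[j]? ↔
      (t.leaves.map Prod.fst)[i]? = (t.leaves.map Prod.fst)[j]?)) ∧
  (∀ i < s.size, ∀ j < s.size,
    (s.leaves[i]? = s.leaves[j]? ↔ t.leaves[i]? = t.leaves[j]?))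

theorem equivalent_equivalence : Equivalence Equivalent where
  refl _ := ⟨rfl, fun _ _ _ _ => Iff.rfl, fun _ _ _ _ => Iff.rfl⟩
  symm {s t} h := by
    have e : s.size = t.size := ConnTree.size_eq_of_treeStructure_eq h.1
    refine ⟨h.1.symm, fun i hi j hj => ?_, fun i hi j hj => ?_⟩
    · exact (h.2.1 i (e ▸ hi) j (e ▸ hj)).symm
    · exact (h.2.2 i (e ▸ hi) j (e ▸ hj)).symm
  trans {s t u} h h' := by
    have e : s.size = t.size := ConnTree.size_eq_of_treeStructure_eq h.1
    refine ⟨h.1.trans h'.1, fun i hi j hj => ?_, fun i hi j hj => ?_⟩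
    · exact (h.2.1 i hi j hj).trans (h'.2.1 i (e ▸ hi) j (e ▸ hj))
    · exact (h.2.2 i hi j hj).trans (h'.2.2 i (e ▸ hi) j (e ▸ hj))

def equivalentSetoid : Setoid AndOrTree := ⟨Equivalent, equivalent_equivalence⟩

end AndOrTree

/-- Equivalence classes of and/or trees. -/
def AndOrClass : Type := Quotient AndOrTree.equivalentSetoid

/-- The equivalence class of a tree. -/
def AndOrTree.toClass (t : AndOrTree) : AndOrClass := Quotient.mk AndOrTree.equivalentSetoid t

/-- The family of tautologies. -/
def tautologies : Set AndOrTree := {t | t.IsTautology}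

/-- The family of simple tautologies. -/
def simpleTautologies : Set AndOrTree := {t | t.IsSimpleTautology}

/-- The family of equivalence classes of tautologies. -/
def tautologyClasses : Set AndOrClass := AndOrTree.toClass '' tautologies

/-- The family of equivalence classes of simple tautologies. -/
def simpleTautologyClasses : Set AndOrClass := AndOrTree.toClass '' simpleTautologies

/-- The sample space of the generalised model (G): the trees of size `n` labelled with the first
`k` variables. -/
def treesG (n k : ℕ) : Set AndOrTree := {t | t.size = n ∧ t.UsesVars k}

/-- The sample space of the quotient model (E): the equivalence classes of trees of size `n` having
at least one element labelled with the first `k` variables. -/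
def classesE (n k : ℕ) : Set AndOrClass := AndOrTree.toClass '' treesG n k

noncomputable section

/-- The ratio of a family of trees in model (G). -/
def muG (k : ℕ → ℕ) (F : Set AndOrTree) (n : ℕ) : ℝ :=
  ((F ∩ treesG n (k n)).ncard : ℝ) / ((treesG n (k n)).ncard : ℝ)

/-- The ratio of a family of equivalence classes of trees in model (E). -/
def muE (k : ℕ → ℕ) (F : Set AndOrClass) (n : ℕ) : ℝ :=
  ((F ∩ classesE n (k n)).ncard : ℝ) / ((classesE n (k n)).ncard : ℝ)

/-- `Lab_{n,m}` in model (G). -/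
def labG (n m : ℕ) : ℝ := (2 * (m : ℝ)) ^ n

/-- `Lab_{n,m}` in model (E), with Stirling numbers of the second kind. -/
def labE (n m : ℕ) : ℝ :=
  2 ^ n * ∑ p ∈ Finset.Icc 1 m, (Nat.stirlingSecond n p : ℝ) * (2 ^ p)⁻¹

/-- `rat_n` in model (G). -/
def ratG (k : ℕ → ℕ) (n : ℕ) : ℝ := labG (n - 1) (k n) / labG n (k n)

/-- `rat_n` in model (E). -/
def ratE (k : ℕ → ℕ) (n : ℕ) : ℝ := labE (n - 1) (k n) / labE n (k n)

end

/-!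
A random tree is a uniformly random tree-structure of size `n` together with a random labelling of
its leaves. In both models the labellings may be taken to be maps from the positions of the leaves
to the literals of the first `k` variables, where a labelling with `p` different variables has
a weight depending on `p` only: the weight is `1` in the generalised model, and in the quotient
model it is the reciprocal `1 / (k.descFactorial p * 2 ^ p)` of the size of the equivalence class
(`Labelling.card_sameType`), so that weights of families are numbers of classes
(`Labelling.ncard_inter_classesE`). For every such weight, prescribing that two given positions
carry opposite literals amounts to removing one position, and prescribing two different coincidences
of variables amounts to removing two (`Labelling.sum_opposite`, `Labelling.sum_two_sameVar`).
Writing `Lab n` for the total weight, these events have probabilities `Lab (n - 1) / Lab n` and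
`4 * Lab (n - 2) / Lab n`, and the second is negligible compared with the first. In the quotient
model this is a statement about Stirling numbers (`Labelling.exists_mul_labE_le`).

For simple tautologies, the first two Bonferroni inequalities reduce the claim to the mean number
of pairs of leaves that are joined to the root by disjunctions. If `T = z + 2 T²` is the generating
function of the tree-structures, these pairs have the generating function `T² / (1 - 2T) = T³ / z`.
By the quadratic equation this is linear in `T` over the rational functions in `z`,
and the mean is seen to tend to `3/2`
(`ConnTree.four_mul_orPairs`, `ConnTree.tendsto_orPairs_div`).

For a tautology that is not simple, consider the leaves reached by following both children of each
`∨` and the left child of each `∧`. They cannot all be made false, so two of them are opposite. One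
of these two lies below an `∧`; replacing there the left child by the right child gives a second
set of leaves, avoiding that leaf, which cannot be made false either. So two different pairs of
leaves in the wide pattern carry twice the same variable
(`AndOrTree.twoRepetitions_of_isTautology`). The number of ways to choose these pairs is
bounded in mean, because all moments of the size of the wide pattern are
(`ConnTree.dominated_gf_widePattern_pow`): the generating functions of the moments are polynomials
in `z`, `T` and `1 / (1 - 3T)`, and the denominator does not vanish at the singularity `z = 1/8`,
where `T = 1/4`.
-/

/-! ### Relabelling, patterns and cuts -/

namespace ConnTree

variable {α β : Type}

/-- The tree obtained by applying a function to all leaf labels. -/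
def map (f : α → β) : ConnTree α → ConnTree β
  | leaf a => leaf (f a)
  | node c l r => node c (l.map f) (r.map f)

/-- The truth value of a tree whose leaves have the truth values `v`. -/
def truth (v : α → Bool) : ConnTree α → Bool
  | leaf a => v a
  | node .conj l r => truth v l && truth v r
  | node .disj l r => truth v l || truth v r

/-- The leaves that are reached from the root by following both children of a `∨` and the left
child of a `∧`. If they are all false, then so is the tree. -/
def leftPattern : ConnTree α → List α
  | leaf a => [a]
  | node .disj l r => l.leftPattern ++ r.leftPattern
  | node .conj l _ => l.leftPattern

/-- The leaves that are reached from the root by following both children of a `∨` and the left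
child of a `∧`, and turning at most once into the right child of a `∧`. -/
def widePattern : ConnTree α → List α
  | leaf a => [a]
  | node .disj l r => l.widePattern ++ r.widePattern
  | node .conj l r => l.widePattern ++ r.leftPattern

theorem leaves_map (f : α → β) (t : ConnTree α) : (t.map f).leaves = t.leaves.map f := by
  induction t with
  | leaf a => rfl
  | node c l r hl hr => simp [map, leaves, hl, hr]

theorem orLeaves_map (f : α → β) (t : ConnTree α) : (t.map f).orLeaves = t.orLeaves.map f := by
  induction t with
  | leaf a => rfl
  | node c l r hl hr => cases c <;> simp [map, orLeaves, hl, hr]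

theorem leftPattern_map (f : α → β) (t : ConnTree α) :
    (t.map f).leftPattern = t.leftPattern.map f := by
  induction t with
  | leaf a => rfl
  | node c l r hl hr => cases c <;> simp [map, leftPattern, hl, hr]

theorem widePattern_map (f : α → β) (t : ConnTree α) :
    (t.map f).widePattern = t.widePattern.map f := by
  induction t with
  | leaf a => rfl
  | node c l r hl hr => cases c <;> simp [map, widePattern, leftPattern_map, hl, hr]

theorem truth_map (f : α → β) (v : β → Bool) (t : ConnTree α) :
    (t.map f).truth v = t.truth (v ∘ f) := by
  induction t with
  | leaf a => rfl
  | node c l r hl hr => cases c <;> simp [map, truth, hl, hr]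

theorem treeStructure_eq_map (t : ConnTree α) : t.treeStructure = t.map fun _ => () := by
  induction t with
  | leaf a => rfl
  | node c l r hl hr => simp [map, treeStructure, hl, hr]

theorem treeStructure_map (f : α → β) (t : ConnTree α) :
    (t.map f).treeStructure = t.treeStructure := by
  induction t with
  | leaf a => rfl
  | node c l r hl hr => simp [map, treeStructure, hl, hr]

theorem length_orLeaves_treeStructure (t : ConnTree α) :
    t.treeStructure.orLeaves.length = t.orLeaves.length := by
  simp [treeStructure_eq_map, orLeaves_map]

theorem length_widePattern_treeStructure (t : ConnTree α) :
    t.treeStructure.widePattern.length = t.widePattern.length := by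
  simp [treeStructure_eq_map, widePattern_map]

theorem size_pos (t : ConnTree α) : 0 < t.size := by
  induction t with
  | leaf a => simp [size, leaves]
  | node c l r hl hr => simp only [size, leaves, List.length_append] at *; omega

theorem size_node (c : Connective) (l r : ConnTree α) : (node c l r).size = l.size + r.size := by
  simp [size, leaves]

/-- A tree is determined by its structure and the list of its leaf labels. -/
theorem eq_of_treeStructure_eq_of_leaves_eq {s t : ConnTree α}
    (h : s.treeStructure = t.treeStructure) (h' : s.leaves = t.leaves) : s = t := by
  induction s generalizing t with
  | leaf a =>
    cases t with
    | leaf b => simpa [leaves] using h'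
    | node c l r => simp [treeStructure] at h
  | node c l r hl hr =>
    cases t with
    | leaf b => simp [treeStructure] at h
    | node c' l' r' =>
      simp only [treeStructure, node.injEq] at h
      obtain ⟨rfl, h1, h2⟩ := h
      obtain ⟨h3, h4⟩ := List.append_inj h' (size_eq_of_treeStructure_eq h1)
      rw [hl h1 h3, hr h2 h4]

theorem exists_treeStructure_eq_leaves_eq (s : ConnTree Unit) (u : List α)
    (hu : u.length = s.size) : ∃ t : ConnTree α, t.treeStructure = s ∧ t.leaves = u := by
  induction s generalizing u with
  | leaf a =>
    obtain ⟨b, rfl⟩ := List.length_eq_one_iff.1 hu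
    exact ⟨leaf b, rfl, rfl⟩
  | node c l r hl hr =>
    rw [size_node] at hu
    obtain ⟨t₁, rfl, h₁⟩ := hl (u.take l.size) (by simp; omega)
    obtain ⟨t₂, rfl, h₂⟩ := hr (u.drop t₁.treeStructure.size) (by simp; omega)
    exact ⟨node c t₁ t₂, rfl, by simp [leaves, h₁, h₂]⟩

theorem orLeaves_sublist_leftPattern (t : ConnTree α) : t.orLeaves.Sublist t.leftPattern := by
  induction t with
  | leaf a => exact List.Sublist.refl _
  | node c l r hl hr =>
    cases c
    · exact List.nil_sublist _
    · exact hl.append hr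

theorem leftPattern_sublist_widePattern (t : ConnTree α) :
    t.leftPattern.Sublist t.widePattern := by
  induction t with
  | leaf a => exact List.Sublist.refl _
  | node c l r hl hr =>
    cases c
    · exact hl.trans (List.sublist_append_left _ _)
    · exact hl.append hr

theorem leftPattern_sublist_leaves (t : ConnTree α) : t.leftPattern.Sublist t.leaves := by
  induction t with
  | leaf a => exact List.Sublist.refl _
  | node c l r hl hr =>
    cases c
    · exact hl.trans (List.sublist_append_left _ _)
    · exact hl.append hr

theorem orLeaves_sublist_leaves (t : ConnTree α) : t.orLeaves.Sublist t.leaves :=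
  t.orLeaves_sublist_leftPattern.trans t.leftPattern_sublist_leaves

theorem length_orLeaves_le_widePattern (t : ConnTree α) :
    t.orLeaves.length ≤ t.widePattern.length :=
  (t.orLeaves_sublist_leftPattern.trans t.leftPattern_sublist_widePattern).length_le

/-- A cut of a tree: a set of leaf labels which, when all false, make the tree false. -/
def IsCut (C : Set α) (t : ConnTree α) : Prop :=
  ∀ v : α → Bool, (∀ a ∈ C, v a = false) → t.truth v = false

theorem isCut_leftPattern (t : ConnTree α) : t.IsCut {a | a ∈ t.leftPattern} := by
  induction t with
  | leaf a => intro v hv; exact hv a (by simp [leftPattern])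
  | node c l r hl hr =>
    intro v hv
    cases c
    · simp [truth, hl v fun a ha => hv a ha]
    · simp [truth, hl v fun a ha => hv a (List.mem_append_left _ ha),
        hr v fun a ha => hv a (List.mem_append_right _ ha)]

/-- A leaf of the left pattern below some `∧` can be avoided by a cut inside the wide pattern:
at that `∧`, the left pattern of the right child replaces the left pattern of the left child. -/
theorem exists_isCut_not_mem {t : ConnTree α} (ht : t.leaves.Nodup) {a : α}
    (ha : a ∈ t.leftPattern) (ha' : a ∉ t.orLeaves) :
    ∃ C : Set α, t.IsCut C ∧ (∀ b ∈ C, b ∈ t.widePattern) ∧ a ∉ C := by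
  induction t with
  | leaf b => exact absurd ha ha'
  | node c l r hl hr =>
    obtain ⟨hnl, hnr, hd⟩ := List.nodup_append.1 ht
    cases c
    · refine ⟨{b | b ∈ r.leftPattern}, fun v hv => ?_, fun b hb => List.mem_append_right _ hb,
        fun h => ?_⟩
      · simp [truth, r.isCut_leftPattern v hv]
      · exact hd a (l.leftPattern_sublist_leaves.subset ha) a
          (r.leftPattern_sublist_leaves.subset h) rfl
    · simp only [orLeaves, List.mem_append, not_or] at ha'
      rcases List.mem_append.1 ha with h | h
      · obtain ⟨C, h₁, h₂, h₃⟩ := hl hnl h ha'.1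
        refine ⟨C ∪ {b | b ∈ r.leftPattern}, fun v hv => ?_, fun b hb => ?_, fun hb => ?_⟩
        · simp [truth, h₁ v fun a ha => hv a (Or.inl ha),
            r.isCut_leftPattern v fun a ha => hv a (Or.inr ha)]
        · exact List.mem_append.2
            (hb.imp (h₂ b) fun hb => r.leftPattern_sublist_widePattern.subset hb)
        · exact hb.elim h₃ fun hb => hd a (l.leftPattern_sublist_leaves.subset h) a
            (r.leftPattern_sublist_leaves.subset hb) rfl
      · obtain ⟨C, h₁, h₂, h₃⟩ := hr hnr h ha'.2
        refine ⟨C ∪ {b | b ∈ l.leftPattern}, fun v hv => ?_, fun b hb => ?_, fun hb => ?_⟩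
        · simp [truth, h₁ v fun a ha => hv a (Or.inl ha),
            l.isCut_leftPattern v fun a ha => hv a (Or.inr ha)]
        · exact List.mem_append.2
            (hb.symm.imp (fun hb => l.leftPattern_sublist_widePattern.subset hb) (h₂ b))
        · exact hb.elim h₃ fun hb => hd a (l.leftPattern_sublist_leaves.subset hb) a
            (r.leftPattern_sublist_leaves.subset h) rfl

end ConnTree

/-! ### Tautologies that are not simple have two repetitions -/

namespace AndOrTree

/-- The truth value of a literal. -/
def litTruth (x : ℕ → Bool) (a : Literal) : Bool := if a.2 then x a.1 else !x a.1

theorem eval_eq_truth (x : ℕ → Bool) (t : AndOrTree) :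
    eval x t = ConnTree.truth (litTruth x) t := by
  induction t with
  | leaf a => obtain ⟨i, b⟩ := a; cases b <;> rfl
  | node c l r hl hr => cases c <;> simp [eval, ConnTree.truth, hl, hr]

/-- Two literals are opposite if they are a variable and its negation. -/
def AreOpposite (a b : Literal) : Prop := a.1 = b.1 ∧ a ≠ b

theorem isSimpleTautology_map_iff {ι : Type} (f : ι → Literal) (q : ConnTree ι) :
    IsSimpleTautology (q.map f) ↔ ∃ i ∈ q.orLeaves, ∃ j ∈ q.orLeaves, AreOpposite (f i) (f j) := by
  simp only [IsSimpleTautology, ConnTree.orLeaves_map, List.mem_map]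
  constructor
  · rintro ⟨v, ⟨i, hi, hi'⟩, ⟨j, hj, hj'⟩⟩
    exact ⟨i, hi, j, hj, by simp [AreOpposite, hi', hj']⟩
  · rintro ⟨i, hi, j, hj, h, h'⟩
    rcases hb : (f i).2 with _ | _
    · exact ⟨(f i).1, ⟨j, hj, Prod.ext h.symm (by
        by_contra hc
        exact h' (Prod.ext h (by cases hd : (f j).2 <;> simp_all)))⟩, ⟨i, hi, Prod.ext rfl hb⟩⟩
    · exact ⟨(f i).1, ⟨i, hi, Prod.ext rfl hb⟩, ⟨j, hj, Prod.ext h.symm (by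
        by_contra hc
        exact h' (Prod.ext h (by cases hd : (f j).2 <;> simp_all)))⟩⟩

/-- Every cut of a tautology contains a pair of opposite literals: otherwise all its literals
could be made false simultaneously. -/
theorem exists_opposite_of_isCut {ι : Type} {f : ι → Literal} {q : ConnTree ι}
    (h : IsTautology (q.map f)) {C : Set ι} (hC : q.IsCut C) :
    ∃ i ∈ C, ∃ j ∈ C, AreOpposite (f i) (f j) := by
  classical
  by_contra! hno
  have h1 := h fun v => decide (∃ j ∈ C, f j = (v, false))
  rw [eval_eq_truth, ConnTree.truth_map, hC] at h1
  · exact Bool.false_ne_true h1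
  · intro i hi
    rcases hb : (f i).2 with _ | _
    · simp only [Function.comp, litTruth, hb]
      simpa using ⟨i, hi, Prod.ext rfl hb⟩
    · simp only [Function.comp, litTruth, hb, if_true, decide_eq_false_iff_not]
      rintro ⟨j, hj, hj'⟩
      exact hno i hi j hj ⟨by simp [hj'], fun e => by
        rw [e, hj'] at hb
        exact Bool.false_ne_true hb⟩

theorem IsSimpleTautology.isTautology {t : AndOrTree} (h : t.IsSimpleTautology) :
    t.IsTautology := by
  have key : ∀ (t : AndOrTree) (x : ℕ → Bool) (a : Literal), a ∈ t.orLeaves →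
      litTruth x a = true → eval x t = true := by
    intro t x a ha hx
    rw [eval_eq_truth]
    induction t with
    | leaf b => simp only [ConnTree.orLeaves, List.mem_singleton] at ha; subst ha; exact hx
    | node c l r hl hr =>
      cases c
      · simp [ConnTree.orLeaves] at ha
      · rcases List.mem_append.1 ha with ha | ha
        · simp [ConnTree.truth, hl ha]
        · simp [ConnTree.truth, hr ha]
  obtain ⟨i, h1, h2⟩ := h
  intro x
  cases hx : x i
  · exact key t x _ h2 (by simp [litTruth, hx])
  · exact key t x _ h1 (by simp [litTruth, hx])

/-- Two different pairs of positions in a list carry twice the same variable, where `v` gives the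
variables at the positions. -/
def TwoRepetitions {ι κ : Type} (v : ι → κ) (P : List ι) : Prop :=
  ∃ i ∈ P, ∃ j ∈ P, ∃ k ∈ P, ∃ l ∈ P, i ≠ j ∧ k ≠ l ∧ ¬(i = k ∧ j = l) ∧ ¬(i = l ∧ j = k) ∧
    v i = v j ∧ v k = v l

theorem twoRepetitions_of_isTautology {ι : Type} {f : ι → Literal} {q : ConnTree ι}
    (hq : q.leaves.Nodup) (h : IsTautology (q.map f)) (h' : ¬ IsSimpleTautology (q.map f)) :
    TwoRepetitions (fun i => (f i).1) q.widePattern := by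
  obtain ⟨i, hi, j, hj, hij⟩ := exists_opposite_of_isCut h q.isCut_leftPattern
  have hN := q.leftPattern_sublist_widePattern.subset
  have main : ∀ a ∈ q.leftPattern, a ∉ q.orLeaves → (a = i ∨ a = j) →
      TwoRepetitions (fun i => (f i).1) q.widePattern := by
    intro a ha ha' hor
    obtain ⟨C, hC, hCP, haC⟩ := ConnTree.exists_isCut_not_mem hq ha ha'
    obtain ⟨k, hk, l, hl, hkl⟩ := exists_opposite_of_isCut h hC
    refine ⟨i, hN hi, j, hN hj, k, hCP k hk, l, hCP l hl, fun e => hij.2 (by rw [e]),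
      fun e => hkl.2 (by rw [e]), ?_, ?_, hij.1, hkl.1⟩
    · rintro ⟨rfl, rfl⟩
      rcases hor with rfl | rfl <;> contradiction
    · rintro ⟨rfl, rfl⟩
      rcases hor with rfl | rfl <;> contradiction
  by_cases hi' : i ∈ q.orLeaves
  · by_cases hj' : j ∈ q.orLeaves
    · exact absurd ((isSimpleTautology_map_iff f q).2 ⟨i, hi', j, hj', hij⟩) h'
    · exact main j hj hj' (Or.inr rfl)
  · exact main i hi hi' (Or.inl rfl)

end AndOrTree

/-! ### Generating functions of tree-structures -/

namespace ConnTree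

theorem finite_setOf_size_eq (n : ℕ) : {s : ConnTree Unit | s.size = n}.Finite := by
  induction n using Nat.strong_induction_on with
  | _ n ih =>
    have h : ∀ c : Connective, (⋃ i ∈ Set.Iio n, ⋃ j ∈ Set.Iio n,
        Set.image2 (node c) {s : ConnTree Unit | s.size = i} {s | s.size = j}).Finite :=
      fun c => (Set.finite_Iio n).biUnion fun i hi => (Set.finite_Iio n).biUnion fun j hj =>
        (ih i hi).image2 _ (ih j hj)
    refine (((Set.finite_singleton (leaf ())).union (h .conj)).union (h .disj)).subset ?_
    intro s hs
    cases s with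
    | leaf a => exact Or.inl (Or.inl rfl)
    | node c l r =>
      have hl := l.size_pos
      have hr := r.size_pos
      simp only [Set.mem_ofPred_eq, size_node] at hs
      have : node c l r ∈ ⋃ i ∈ Set.Iio n, ⋃ j ∈ Set.Iio n,
          Set.image2 (node c) {s : ConnTree Unit | s.size = i} {s | s.size = j} := by
        simp only [Set.mem_iUnion]
        exact ⟨l.size, by simp; omega, r.size, by simp; omega, l, rfl, r, rfl, rfl⟩
      cases c
      · exact Or.inl (Or.inr this)
      · exact Or.inr this

/-- The tree-structures of size `n`. -/
noncomputable def structures (n : ℕ) : Finset (ConnTree Unit) := (finite_setOf_size_eq n).toFinset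

@[simp]
theorem mem_structures {n : ℕ} {s : ConnTree Unit} : s ∈ structures n ↔ s.size = n := by
  simp [structures]

theorem sum_structures (n : ℕ) (F : ConnTree Unit → ℝ) :
    ∑ s ∈ structures n, F s = (if n = 1 then F (leaf ()) else 0) +
      ∑ ij ∈ Finset.HasAntidiagonal.antidiagonal n, ∑ l ∈ structures ij.1, ∑ r ∈ structures ij.2,
        (F (node .disj l r) + F (node .conj l r)) := by
  classical
  set U := (Finset.HasAntidiagonal.antidiagonal n).sigma
    fun ij => structures ij.1 ×ˢ structures ij.2 with hU
  have hinj : ∀ c, Set.InjOn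
      (fun x : (Σ _ : ℕ × ℕ, ConnTree Unit × ConnTree Unit) => node c x.2.1 x.2.2) U := by
    rintro c ⟨⟨i, j⟩, l, r⟩ h ⟨⟨i', j'⟩, l', r'⟩ h' e
    simp only [hU, Finset.coe_sigma, Set.mem_sigma_iff, Finset.mem_coe, Finset.mem_product,
      mem_structures] at h h'
    simp only [node.injEq, true_and] at e
    obtain ⟨rfl, rfl⟩ := e
    obtain ⟨-, rfl, rfl⟩ := h
    obtain ⟨-, rfl, rfl⟩ := h'
    rfl
  have hdec : structures n = ((if n = 1 then {leaf ()} else ∅) ∪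
      U.image fun x => node .disj x.2.1 x.2.2) ∪ U.image fun x => node .conj x.2.1 x.2.2 := by
    ext s
    cases s with
    | leaf a =>
      by_cases h : n = 1
      · simp [h, size, leaves]
      · simp [h, size, leaves, Ne.symm h]
    | node c l r =>
      have h1 : node c l r ∉ (if n = 1 then {leaf ()} else ∅ : Finset (ConnTree Unit)) := by
        split_ifs <;> simp
      cases c <;> simp [h1, hU, size_node]
  rw [hdec, Finset.sum_union, Finset.sum_union, Finset.sum_image (hinj _),
    Finset.sum_image (hinj _), add_assoc, ← Finset.sum_add_distrib, hU, Finset.sum_sigma]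
  · congr 1
    · split_ifs <;> simp
    · refine Finset.sum_congr rfl fun ij _ => ?_
      rw [Finset.sum_product]
  · split_ifs <;> simp [Finset.disjoint_left]
  · rw [Finset.disjoint_left]
    intro s hs
    split_ifs at hs <;> simp at hs ⊢
    · rcases hs with rfl | ⟨_, _, _, _, _, rfl⟩ <;> simp
    · rcases hs with ⟨_, _, _, _, _, rfl⟩; simp

open PowerSeries

/-- The generating function of the sums of a statistic over the tree-structures of each size. -/
noncomputable def gf (F : ConnTree Unit → ℝ) : PowerSeries ℝ :=
  PowerSeries.mk fun n => ∑ s ∈ structures n, F s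

theorem coeff_gf (n : ℕ) (F : ConnTree Unit → ℝ) :
    coeff n (gf F) = ∑ s ∈ structures n, F s := coeff_mk _ _

/-- If a statistic of a node is a sum of products of statistics of its children, then its
generating function is the corresponding sum of products. -/
theorem gf_eq {ι : Type*} (I : Finset ι) {F : ConnTree Unit → ℝ} (A B : ι → ConnTree Unit → ℝ)
    {c : ℝ} (hc : F (leaf ()) = c)
    (h : ∀ l r, F (node .disj l r) + F (node .conj l r) = ∑ i ∈ I, A i l * B i r) :
    gf F = C c * X + ∑ i ∈ I, gf (A i) * gf (B i) := by
  ext n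
  rw [coeff_gf, sum_structures, map_add, map_sum, coeff_C_mul, coeff_X, hc]
  congr 1
  · split_ifs <;> simp
  · simp only [h, coeff_mul, coeff_gf]
    rw [Finset.sum_comm]
    refine Finset.sum_congr rfl fun ij _ => ?_
    simp only [Finset.sum_mul_sum]
    rw [Finset.sum_comm]
    simp only [Finset.sum_comm (s := structures ij.2)]
    rw [Finset.sum_comm]

theorem gf_const_mul (c : ℝ) (F : ConnTree Unit → ℝ) : gf (fun s => c * F s) = C c * gf F := by
  ext n
  simp [coeff_gf, Finset.mul_sum]

/-- The generating function of the tree-structures. -/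
noncomputable def treeGF : PowerSeries ℝ := gf fun _ => 1

theorem coeff_treeGF (n : ℕ) : coeff n treeGF = ((structures n).card : ℝ) := by
  simp [treeGF, coeff_gf]

theorem treeGF_eq : treeGF = X + 2 * treeGF * treeGF := by
  have h := gf_eq (Finset.univ : Finset Unit) (F := fun _ => 1) (fun _ _ => 2 * 1) (fun _ _ => 1)
    rfl (fun l r => by norm_num)
  rw [gf_const_mul] at h
  simpa [treeGF, map_ofNat] using h

theorem card_structures_zero : (structures 0).card = 0 := by
  rw [Finset.card_eq_zero, Finset.eq_empty_iff_forall_notMem]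
  intro s hs
  have := s.size_pos
  simp at hs
  omega

theorem card_structures_succ (n : ℕ) : ((structures (n + 1)).card : ℝ) = 2 ^ n * catalan n := by
  have hrec : ∀ m, ((structures m).card : ℝ) = (if m = 1 then 1 else 0) +
      2 * ∑ ij ∈ Finset.HasAntidiagonal.antidiagonal m,
        ((structures ij.1).card : ℝ) * (structures ij.2).card := by
    intro m
    have h := congrArg (coeff m) treeGF_eq
    have h2 : (2 : PowerSeries ℝ) = C 2 := (map_ofNat C 2).symm
    rw [h2, mul_assoc, map_add, coeff_C_mul, coeff_mul, coeff_X] at h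
    simpa only [coeff_treeGF] using h
  induction n using Nat.strong_induction_on with
  | _ n ih =>
    cases n with
    | zero =>
      rw [hrec, Finset.Nat.antidiagonal_succ]
      simp [card_structures_zero]
    | succ n =>
      rw [hrec, Finset.Nat.antidiagonal_succ_succ', catalan_succ']
      simp only [Finset.sum_cons, Finset.sum_map, card_structures_zero]
      push_cast
      simp only [Function.Embedding.prodMap, Function.Embedding.coeFn_mk, Prod.map, zero_mul,
        mul_zero, zero_add, Finset.mul_sum]
      refine Finset.sum_congr rfl fun ij hij => ?_
      have hij' := Finset.HasAntidiagonal.mem_antidiagonal.1 hij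
      rw [show Nat.succ ij.1 = ij.1 + 1 from rfl, show Nat.succ ij.2 = ij.2 + 1 from rfl,
        ih ij.1 (by omega), ih ij.2 (by omega), ← hij']
      ring

theorem card_structures_pos {n : ℕ} (hn : 1 ≤ n) : (0 : ℝ) < (structures n).card := by
  obtain ⟨m, rfl⟩ := Nat.exists_eq_add_of_le' hn
  rw [card_structures_succ]
  have h : 0 < catalan m := by
    have h1 := succ_mul_catalan_eq_centralBinom m
    have h2 := m.centralBinom_pos
    exact Nat.pos_of_ne_zero fun h => by simp [h] at h1; omega
  positivity

theorem succ_mul_card_structures {n : ℕ} (hn : 1 ≤ n) :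
    ((n : ℝ) + 1) * (structures (n + 1)).card = (8 * n - 4) * (structures n).card := by
  obtain ⟨m, rfl⟩ := Nat.exists_eq_add_of_le' hn
  rw [card_structures_succ, card_structures_succ]
  have h0 : ((m : ℝ) + 1) * catalan m = m.centralBinom := by
    exact_mod_cast succ_mul_catalan_eq_centralBinom m
  have h1 : ((m : ℝ) + 1 + 1) * catalan (m + 1) = (m + 1).centralBinom := by
    exact_mod_cast succ_mul_catalan_eq_centralBinom (m + 1)
  have h2 : ((m : ℝ) + 1) * (m + 1).centralBinom = 2 * (2 * m + 1) * m.centralBinom := by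
    exact_mod_cast Nat.succ_mul_centralBinom_succ m
  rw [← h0, ← h1] at h2
  have h3 : ((m : ℝ) + 1) ≠ 0 := by positivity
  push_cast
  apply mul_left_cancel₀ h3
  rw [pow_succ]
  linear_combination (2 ^ m * 2) * h2

theorem card_structures_succ_le (n : ℕ) (hn : 1 ≤ n) :
    ((structures (n + 1)).card : ℝ) ≤ 8 * (structures n).card := by
  have h := succ_mul_card_structures hn
  have h0 : (0 : ℝ) ≤ (structures n).card := Nat.cast_nonneg _
  have h1 : (0 : ℝ) < (n : ℝ) + 1 := by positivity
  refine le_of_mul_le_mul_left ?_ h1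
  rw [h]
  nlinarith

theorem card_structures_le (n : ℕ) : ((structures n).card : ℝ) ≤ 8 ^ n := by
  induction n with
  | zero => simp [card_structures_zero]
  | succ n ih =>
    rcases Nat.eq_zero_or_pos n with rfl | hn
    · rw [card_structures_succ]; norm_num
    · refine (card_structures_succ_le n hn).trans ?_
      rw [pow_succ]
      linarith

theorem tendsto_card_structures_succ_div :
    Tendsto (fun n : ℕ => ((structures (n + 1)).card : ℝ) / (structures n).card) atTop
      (nhds 8) := by
  have h : Tendsto (fun n : ℕ => (8 : ℝ) - 12 * (1 / ((n : ℝ) + 1))) atTop (nhds (8 - 12 * 0)) :=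
    tendsto_const_nhds.sub (tendsto_one_div_add_atTop_nhds_zero_nat.const_mul 12)
  rw [mul_zero, sub_zero] at h
  refine h.congr' ?_
  filter_upwards [eventually_ge_atTop 1] with n hn
  have h0 := card_structures_pos hn
  have h1 : (0 : ℝ) < (n : ℝ) + 1 := by positivity
  have h2 := succ_mul_card_structures hn
  field_simp
  linear_combination -h2

/-! ### Pairs of leaves joined to the root by disjunctions -/

/-- The number of pairs of leaves that are joined to the root by disjunctions only, summed over
all tree-structures of size `n`. -/
noncomputable def orPairs (n : ℕ) : ℝ :=
  ∑ s ∈ structures n, (s.orLeaves.length.choose 2 : ℝ)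

theorem one_sub_two_mul_treeGF_ne_zero : (1 - 2 * treeGF : PowerSeries ℝ) ≠ 0 := by
  intro h
  have h0 := congrArg (coeff 0) h
  have h2 : (2 : PowerSeries ℝ) = C 2 := (map_ofNat C 2).symm
  rw [h2, map_sub, coeff_C_mul, coeff_treeGF, card_structures_zero] at h0
  simp at h0

theorem gf_length_orLeaves : gf (fun s => (s.orLeaves.length : ℝ)) = treeGF := by
  have h := gf_eq (Finset.univ : Finset Bool) (F := fun s => (s.orLeaves.length : ℝ))
    (fun b s => if b then (s.orLeaves.length : ℝ) else 1)
    (fun b s => if b then 1 else (s.orLeaves.length : ℝ)) (c := 1)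
    (by simp [orLeaves]) (fun l r => by simp [orLeaves])
  simp only [Fintype.sum_bool, if_true, Bool.false_eq_true, if_false, map_one, one_mul] at h
  change _ = X + (_ * treeGF + treeGF * _) at h
  apply mul_right_cancel₀ one_sub_two_mul_treeGF_ne_zero
  linear_combination h - treeGF_eq

theorem four_mul_orPairs {n : ℕ} (hn : 1 ≤ n) :
    4 * orPairs n = (structures (n + 1)).card - 2 * (structures n).card := by
  have h := gf_eq (Finset.univ : Finset (Fin 3)) (F := fun s => (s.orLeaves.length.choose 2 : ℝ))
    ![fun s => (s.orLeaves.length.choose 2 : ℝ), fun s => (s.orLeaves.length : ℝ), fun _ => 1]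
    ![fun _ => 1, fun s => (s.orLeaves.length : ℝ), fun s => (s.orLeaves.length.choose 2 : ℝ)]
    (c := 0) (by simp [orLeaves]) (fun l r => by
      simp only [orLeaves, List.length_append, List.length_nil, Fin.sum_univ_three]
      rw [Nat.add_choose_eq]
      simp [Finset.Nat.antidiagonal_succ]
      ring)
  simp only [Fin.sum_univ_three, Matrix.cons_val_zero, Matrix.cons_val_one, Matrix.cons_val,
    gf_length_orLeaves, map_zero, zero_mul, zero_add] at h
  set G := gf (fun s => (s.orLeaves.length.choose 2 : ℝ)) with hG
  change G = G * treeGF + treeGF * treeGF + treeGF * G at h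
  -- `G (1 - 2T) = T²` and `T (1 - 2T) = z`, so that `z G = T³`, which is linear in `T`.
  have h1 : X * G = treeGF * treeGF * treeGF := by
    linear_combination treeGF * h - G * treeGF_eq
  have h2 : 4 * (X * G) = treeGF - X - 2 * (X * treeGF) := by
    linear_combination 4 * h1 - (1 + 2 * treeGF) * treeGF_eq
  have h3 := congrArg (coeff (n + 1)) h2
  have e2 : (2 : PowerSeries ℝ) = C 2 := (map_ofNat C 2).symm
  have e4 : (4 : PowerSeries ℝ) = C 4 := (map_ofNat C 4).symm
  rw [e2, e4, map_sub, map_sub, coeff_C_mul, coeff_C_mul, coeff_succ_X_mul, coeff_succ_X_mul,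
    coeff_treeGF, coeff_treeGF, coeff_X, if_neg (by omega), hG, coeff_gf] at h3
  rw [orPairs, h3, sub_zero]

theorem tendsto_orPairs_div :
    Tendsto (fun n => orPairs n / (structures n).card) atTop (nhds (3 / 2)) := by
  have h := (tendsto_card_structures_succ_div.sub_const 2).div_const 4
  rw [show ((8 : ℝ) - 2) / 4 = 3 / 2 by norm_num] at h
  refine h.congr' ?_
  filter_upwards [eventually_ge_atTop 1] with n hn
  have h0 := card_structures_pos hn
  have h2 := four_mul_orPairs hn
  field_simp
  linear_combination -h2

end ConnTree

namespace ConnTree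

open PowerSeries

/-! ### Bounded moments of the size of the wide pattern -/

/-- The coefficients are nonnegative and at most a constant times the numbers of
tree-structures. -/
def Dominated (f : PowerSeries ℝ) : Prop :=
  ∃ K : ℝ, ∀ n, 0 ≤ coeff n f ∧ coeff n f ≤ K * (structures n).card

theorem Dominated.add {f g : PowerSeries ℝ} (hf : Dominated f) (hg : Dominated g) :
    Dominated (f + g) := by
  obtain ⟨K, hK⟩ := hf
  obtain ⟨L, hL⟩ := hg
  refine ⟨K + L, fun n => ?_⟩
  rw [map_add, add_mul]
  exact ⟨add_nonneg (hK n).1 (hL n).1, add_le_add (hK n).2 (hL n).2⟩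

theorem dominated_zero : Dominated 0 := ⟨0, fun n => by simp⟩

theorem dominated_treeGF : Dominated treeGF := ⟨1, fun n => by simp [coeff_treeGF]⟩

theorem dominated_X : Dominated X := by
  refine ⟨1, fun n => ?_⟩
  rw [coeff_X]
  split_ifs with h
  · subst h
    rw [card_structures_succ]
    norm_num
  · exact ⟨le_rfl, by positivity⟩

theorem Dominated.const_mul {f : PowerSeries ℝ} (hf : Dominated f) {c : ℝ} (hc : 0 ≤ c) :
    Dominated (C c * f) := by
  obtain ⟨K, hK⟩ := hf
  refine ⟨c * K, fun n => ?_⟩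
  rw [coeff_C_mul, mul_assoc]
  exact ⟨mul_nonneg hc (hK n).1, mul_le_mul_of_nonneg_left (hK n).2 hc⟩

theorem Dominated.sum {ι : Type*} {I : Finset ι} {f : ι → PowerSeries ℝ}
    (hf : ∀ i ∈ I, Dominated (f i)) : Dominated (∑ i ∈ I, f i) := by
  classical
  induction I using Finset.induction_on with
  | empty => exact dominated_zero
  | insert a s ha ih =>
    rw [Finset.sum_insert ha]
    exact (hf a (Finset.mem_insert_self _ _)).add
      (ih fun i hi => hf i (Finset.mem_insert_of_mem hi))

/-- The coefficients of `T²` are at most those of `T`, by the quadratic equation of `T`. -/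
theorem sum_card_mul_card_le (n : ℕ) :
    ∑ ij ∈ Finset.HasAntidiagonal.antidiagonal n,
      ((structures ij.1).card : ℝ) * (structures ij.2).card ≤ (structures n).card := by
  have h := congrArg (coeff n) treeGF_eq
  rw [show (2 : PowerSeries ℝ) = C 2 from (map_ofNat C 2).symm, mul_assoc, map_add, coeff_C_mul,
    coeff_mul, coeff_X] at h
  simp only [coeff_treeGF] at h
  have h0 : (0 : ℝ) ≤ if n = 1 then 1 else 0 := by split_ifs <;> norm_num
  have h1 : 0 ≤ ∑ ij ∈ Finset.HasAntidiagonal.antidiagonal n,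
      ((structures ij.1).card : ℝ) * (structures ij.2).card :=
    Finset.sum_nonneg fun _ _ => by positivity
  linarith

theorem Dominated.mul {f g : PowerSeries ℝ} (hf : Dominated f) (hg : Dominated g) :
    Dominated (f * g) := by
  obtain ⟨K, hK⟩ := hf
  obtain ⟨L, hL⟩ := hg
  refine ⟨|K| * |L|, fun n => ?_⟩
  rw [coeff_mul]
  refine ⟨Finset.sum_nonneg fun _ _ => mul_nonneg (hK _).1 (hL _).1, ?_⟩
  calc _ ≤ ∑ ij ∈ Finset.HasAntidiagonal.antidiagonal n,
        (|K| * (structures ij.1).card) * (|L| * (structures ij.2).card) := by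
        refine Finset.sum_le_sum fun ij _ => mul_le_mul ?_ ?_ (hL _).1 (by positivity)
        · exact (hK _).2.trans (mul_le_mul_of_nonneg_right (le_abs_self K) (by positivity))
        · exact (hL _).2.trans (mul_le_mul_of_nonneg_right (le_abs_self L) (by positivity))
    _ = |K| * |L| * ∑ ij ∈ Finset.HasAntidiagonal.antidiagonal n,
        ((structures ij.1).card : ℝ) * (structures ij.2).card := by
        rw [Finset.mul_sum]
        exact Finset.sum_congr rfl fun _ _ => by ring
    _ ≤ _ := mul_le_mul_of_nonneg_left (sum_card_mul_card_le n) (by positivity)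

theorem summable_card_structures_div :
    Summable fun n : ℕ => ((structures n).card : ℝ) * (1 / 9) ^ n := by
  refine Summable.of_nonneg_of_le (fun n => by positivity) (fun n => ?_)
    (summable_geometric_of_lt_one (r := 8 / 9) (by norm_num) (by norm_num))
  rw [show (8 / 9 : ℝ) = 8 * (1 / 9) by norm_num, mul_pow]
  exact mul_le_mul_of_nonneg_right (card_structures_le n) (by positivity)

/-- The generating function has the value `1/6` or `1/3` at `1/9`. -/
theorem one_sixth_le_tsum_card_structures :
    1 / 6 ≤ ∑' n : ℕ, ((structures n).card : ℝ) * (1 / 9) ^ n := by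
  set s := ∑' n : ℕ, ((structures n).card : ℝ) * (1 / 9) ^ n with hs
  have hsum := summable_card_structures_div
  have hn : Summable fun n : ℕ => ‖((structures n).card : ℝ) * (1 / 9) ^ n‖ := hsum.norm
  have hprod := tsum_mul_tsum_eq_tsum_sum_antidiagonal_of_summable_norm hn hn
  have hps := (summable_norm_sum_mul_antidiagonal_of_summable_norm hn hn).of_norm
  have hterm : ∀ n : ℕ, ((structures n).card : ℝ) * (1 / 9) ^ n = (if n = 1 then 1 / 9 else 0) +
      2 * ∑ kl ∈ Finset.HasAntidiagonal.antidiagonal n,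
        ((structures kl.1).card : ℝ) * (1 / 9) ^ kl.1 *
          (((structures kl.2).card : ℝ) * (1 / 9) ^ kl.2) := by
    intro n
    have h := congrArg (coeff n) treeGF_eq
    rw [show (2 : PowerSeries ℝ) = C 2 from (map_ofNat C 2).symm, mul_assoc, map_add, coeff_C_mul,
      coeff_mul, coeff_X] at h
    simp only [coeff_treeGF] at h
    rw [h, add_mul, mul_assoc 2, Finset.sum_mul]
    congr 1
    · split_ifs with h1
      · simp [h1]
      · simp
    · congr 1
      refine Finset.sum_congr rfl fun kl hkl => ?_
      rw [← Finset.HasAntidiagonal.mem_antidiagonal.1 hkl, pow_add]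
      ring
  have heq : s = 1 / 9 + 2 * (s * s) := by
    rw [hprod, ← tsum_mul_left]
    conv_lhs => rw [hs, tsum_congr hterm]
    rw [Summable.tsum_add (summable_of_hasFiniteSupport
      ((Set.finite_singleton 1).subset fun n hn => by
        by_contra h
        simp only [Set.mem_singleton_iff] at h
        simp [h] at hn)) (hps.mul_left 2), tsum_ite_eq]
  nlinarith [sq_nonneg (s - 1 / 4)]

/-- The series `T / (1 - 3T)`, where `T` is the generating function of the tree-structures. -/
noncomputable def leftGF : PowerSeries ℝ := treeGF * (1 - 3 * treeGF)⁻¹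

theorem constantCoeff_one_sub : constantCoeff (1 - 3 * treeGF) ≠ 0 := by
  have h : constantCoeff treeGF = 0 := by
    rw [← coeff_zero_eq_constantCoeff_apply, coeff_treeGF, card_structures_zero, Nat.cast_zero]
  simp [h]

/-- Conjugating the square root in `T` turns the denominator `1 - 3T` into `1 - 9z`. -/
theorem leftGF_mul : leftGF * (1 - 9 * X) = 3 * X - 2 * treeGF := by
  have h : (1 - 3 * treeGF) * (1 - 3 * treeGF)⁻¹ = 1 := PowerSeries.mul_inv_cancel _
    constantCoeff_one_sub
  have h1 : (1 - 3 * treeGF) * (1 - 6 * treeGF) = 1 - 9 * X := by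
    linear_combination (-9) * treeGF_eq
  have h2 : treeGF * (1 - 6 * treeGF) = 3 * X - 2 * treeGF := by
    linear_combination 3 * treeGF_eq
  rw [← h1, ← h2, leftGF]
  linear_combination (treeGF * (1 - 6 * treeGF)) * h

theorem coeff_leftGF_succ (n : ℕ) : coeff (n + 1) leftGF =
    9 * coeff n leftGF + (if n = 0 then 3 else 0) - 2 * (structures (n + 1)).card := by
  have h := congrArg (coeff (n + 1)) leftGF_mul
  rw [show leftGF * (1 - 9 * X) = leftGF - C 9 * (X * leftGF) by
      rw [show C (9 : ℝ) = (9 : PowerSeries ℝ) from map_ofNat C 9]; ring,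
    show (3 : PowerSeries ℝ) = C 3 from (map_ofNat C 3).symm,
    show (2 : PowerSeries ℝ) = C 2 from (map_ofNat C 2).symm, map_sub, map_sub, coeff_C_mul,
    coeff_C_mul, coeff_C_mul, coeff_succ_X_mul, coeff_X, coeff_treeGF] at h
  simp only [add_eq_right, mul_ite, mul_one, mul_zero] at h
  linarith

theorem coeff_zero_leftGF : coeff 0 leftGF = 0 := by
  have h : constantCoeff treeGF = 0 := by
    rw [← coeff_zero_eq_constantCoeff_apply, coeff_treeGF, card_structures_zero, Nat.cast_zero]
  simp [leftGF, h]

theorem coeff_leftGF (n : ℕ) : coeff (n + 1) leftGF = 9 ^ (n + 1) *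
    (1 / 3 - 2 * ∑ j ∈ Finset.range (n + 2), ((structures j).card : ℝ) * (1 / 9) ^ j) := by
  induction n with
  | zero =>
    rw [coeff_leftGF_succ, coeff_zero_leftGF]
    simp [Finset.sum_range_succ, card_structures_zero]
    ring
  | succ n ih =>
    rw [coeff_leftGF_succ, ih, if_neg (by omega), Finset.sum_range_succ _ (n + 2)]
    have h : (9 : ℝ) ^ (n + 2) * (1 / 9) ^ (n + 2) = 1 := by rw [← mul_pow]; norm_num
    linear_combination (2 * ((structures (n + 2)).card : ℝ)) * h

/-- The recursion multiplies an excess of a coefficient over `16` times the number of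
tree-structures by at least `9`, but the coefficients are `o(9 ^ n)`. -/
theorem coeff_leftGF_le (n : ℕ) : coeff n leftGF ≤ 16 * (structures n).card := by
  rcases Nat.eq_zero_or_pos n with rfl | hn
  · simp [coeff_zero_leftGF]
  by_contra! hlt
  set d := coeff n leftGF - 16 * (structures n).card with hd
  have hd0 : 0 < d := by linarith
  have hgrow : ∀ m, 9 ^ m * d ≤ coeff (n + m) leftGF - 16 * (structures (n + m)).card := by
    intro m
    induction m with
    | zero => simp [hd]
    | succ m ih =>
      have h1 := card_structures_succ_le (n + m) (by omega)
      rw [← add_assoc, coeff_leftGF_succ, if_neg (by omega), pow_succ]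
      linarith
  have hlim : Tendsto (fun m => (1 : ℝ) / 3 - 2 * ∑ j ∈ Finset.range (m + 1),
      ((structures j).card : ℝ) * (1 / 9) ^ j) atTop
      (nhds (1 / 3 - 2 * ∑' n : ℕ, ((structures n).card : ℝ) * (1 / 9) ^ n)) :=
    (((tendsto_add_atTop_iff_nat 1).2
      summable_card_structures_div.hasSum.tendsto_sum_nat).const_mul 2).const_sub _
  have hle : (1 / 9) ^ n * d ≤
      1 / 3 - 2 * ∑' n : ℕ, ((structures n).card : ℝ) * (1 / 9) ^ n := by
    refine ge_of_tendsto hlim ?_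
    filter_upwards [eventually_ge_atTop n] with m hm
    obtain ⟨i, rfl⟩ := Nat.exists_eq_add_of_le hm
    have h1 := hgrow i
    obtain ⟨n', rfl⟩ := Nat.exists_eq_add_of_le' hn
    rw [show n' + 1 + i = n' + i + 1 by ring, coeff_leftGF] at h1
    have h2 : (0 : ℝ) ≤ (structures (n' + i + 1)).card := Nat.cast_nonneg _
    have h3 : (0 : ℝ) < 9 ^ (n' + i + 1) := by positivity
    rw [show n' + 1 + i + 1 = n' + i + 2 by ring]
    refine le_of_mul_le_mul_left (le_trans (le_of_eq ?_) (h1.trans (sub_le_self _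
      (mul_nonneg (by norm_num : (0 : ℝ) ≤ 16) h2)))) h3
    rw [show n' + i + 1 = (n' + 1) + i by ring, pow_add]
    have h : (9 : ℝ) ^ (n' + 1) * (1 / 9) ^ (n' + 1) = 1 := by rw [← mul_pow]; norm_num
    linear_combination (9 ^ i * d) * h
  have h9 : 0 < (1 / 9 : ℝ) ^ n * d := by positivity
  have := one_sixth_le_tsum_card_structures
  linarith

/-- Solutions of linear equations with the factor `3T` stay dominated, because the factor is
subcritical: at the singularity, the generating function `T` has the value `1/4 < 1/3`. -/
theorem Dominated.of_eq {f g : PowerSeries ℝ} (hf : ∀ n, 0 ≤ coeff n f) (hg : Dominated g)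
    (h : f = g + 3 * treeGF * f) : Dominated f := by
  obtain ⟨K, hK⟩ := hg.add (((hg.mul dominated_treeGF).const_mul (c := 16) (by norm_num)).const_mul
    (c := 3) (by norm_num))
  refine ⟨K, fun n => ⟨hf n, le_trans ?_ (hK n).2⟩⟩
  obtain ⟨L, hL⟩ := hg
  have h1 : (1 - 3 * treeGF) * (1 - 3 * treeGF)⁻¹ = 1 := PowerSeries.mul_inv_cancel _
    constantCoeff_one_sub
  have h2 : f = g + C 3 * (g * leftGF) := by
    rw [show C (3 : ℝ) = (3 : PowerSeries ℝ) from map_ofNat C 3, leftGF]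
    linear_combination (1 - 3 * treeGF)⁻¹ * h + (g - f) * h1
  conv_lhs => rw [h2]
  rw [map_add, map_add, coeff_C_mul, coeff_C_mul, coeff_C_mul, coeff_mul, coeff_mul,
    Finset.mul_sum _ _ (16 : ℝ)]
  have : ∑ p ∈ Finset.HasAntidiagonal.antidiagonal n, coeff p.1 g * coeff p.2 leftGF ≤
      ∑ p ∈ Finset.HasAntidiagonal.antidiagonal n, 16 * (coeff p.1 g * coeff p.2 treeGF) := by
    refine Finset.sum_le_sum fun p _ => ?_
    rw [coeff_treeGF, mul_left_comm]
    exact mul_le_mul_of_nonneg_left (coeff_leftGF_le _) (hL _).1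
  linarith

/-- If a statistic is additive at `∨`, and at `∧` it adds to its value at the left child the value
of a statistic with bounded moments at the right child, then its moments are bounded. -/
theorem dominated_gf_pow {A B : ConnTree Unit → ℕ} (hB : ∀ j, Dominated (gf fun s => (B s : ℝ) ^ j))
    (h1 : A (leaf ()) = 1) (hdisj : ∀ l r, A (node .disj l r) = A l + A r)
    (hconj : ∀ l r, A (node .conj l r) = A l + B r) (j : ℕ) :
    Dominated (gf fun s => (A s : ℝ) ^ j) := by
  induction j using Nat.strong_induction_on with
  | _ j ih =>
    cases j with
    | zero => simpa [treeGF] using dominated_treeGF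
    | succ j =>
      set MA : ℕ → PowerSeries ℝ := fun i => gf fun s => (A s : ℝ) ^ i with hMA
      set MB : ℕ → PowerSeries ℝ := fun i => gf fun s => (B s : ℝ) ^ i with hMB
      have hA0 : MA 0 = treeGF := by simp [hMA, treeGF]
      have hB0 : MB 0 = treeGF := by simp [hMB, treeGF]
      have h := gf_eq (Finset.univ ×ˢ Finset.range (j + 2))
        (F := fun s => (A s : ℝ) ^ (j + 1))
        (fun (x : Bool × ℕ) s => ((j + 1).choose x.2 : ℝ) * (A s : ℝ) ^ x.2)
        (fun (x : Bool × ℕ) s =>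
          if x.1 then (A s : ℝ) ^ (j + 1 - x.2) else (B s : ℝ) ^ (j + 1 - x.2))
        (c := 1) (by simp [h1]) (fun l r => by
          rw [Finset.sum_product, Fintype.sum_bool, hdisj, hconj]
          push_cast
          rw [add_pow, add_pow]
          congr 1
          · exact Finset.sum_congr rfl fun i _ => by simp only [if_true]; ring
          · exact Finset.sum_congr rfl fun i _ => by ring)
      rw [Finset.sum_product, Fintype.sum_bool] at h
      simp only [if_true, Bool.false_eq_true, if_false, gf_const_mul, map_one, one_mul] at h
      change MA (j + 1) = X + (∑ i ∈ Finset.range (j + 2), C ((j + 1).choose i : ℝ) * MA i *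
          MA (j + 1 - i) + ∑ i ∈ Finset.range (j + 2), C ((j + 1).choose i : ℝ) * MA i *
          MB (j + 1 - i)) at h
      -- The moment of order `j + 1` occurs on the right in three extreme terms of the binomial
      -- sums, each with the factor `T`; all other terms have moments of lower order of `A`.
      simp only [Finset.sum_range_succ _ (j + 1), Finset.sum_range_succ' _ j, Nat.sub_zero,
        Nat.choose_zero_right, Nat.choose_self, Nat.cast_one, map_one, one_mul, Nat.sub_self,
        hA0, hB0] at h
      refine Dominated.of_eq (f := MA (j + 1)) (fun n => ?_)
        (((dominated_X.add (Dominated.sum (I := Finset.range j)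
          (f := fun i => C ((j + 1).choose (i + 1) : ℝ) * MA (i + 1) * MA (j + 1 - (i + 1)))
          ?_)).add (Dominated.sum (I := Finset.range j)
          (f := fun i => C ((j + 1).choose (i + 1) : ℝ) * MA (i + 1) * MB (j + 1 - (i + 1)))
          ?_)).add (dominated_treeGF.mul (hB (j + 1)))) ?_
      · rw [hMA, coeff_gf]
        positivity
      · intro i hi
        rw [Finset.mem_range] at hi
        exact ((ih _ (by omega)).const_mul (by positivity)).mul (ih _ (by omega))
      · intro i hi
        rw [Finset.mem_range] at hi
        exact ((ih _ (by omega)).const_mul (by positivity)).mul (hB _)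
      · change _ = _ + treeGF * MB (j + 1) + _
        linear_combination h

/-- All moments of the size of the wide pattern of a random tree-structure are bounded. -/
theorem dominated_gf_widePattern_pow (j : ℕ) :
    Dominated (gf fun s => (s.widePattern.length : ℝ) ^ j) := by
  refine dominated_gf_pow (B := fun s => s.leftPattern.length) (fun i => ?_) rfl
    (fun l r => by simp [widePattern]) (fun l r => by simp [widePattern]) j
  refine dominated_gf_pow (B := fun _ => 0) (fun m => ?_) rfl
    (fun l r => by simp [leftPattern]) (fun l r => by simp [leftPattern]) i
  cases m with
  | zero => simpa [treeGF] using dominated_treeGF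
  | succ m =>
    convert dominated_zero
    ext n
    simp [coeff_gf]

theorem exists_sum_widePattern_pow_le (j : ℕ) : ∃ K : ℝ, 0 ≤ K ∧ ∀ n,
    ∑ s ∈ structures n, (s.widePattern.length : ℝ) ^ j ≤ K * (structures n).card := by
  obtain ⟨K, hK⟩ := dominated_gf_widePattern_pow j
  refine ⟨|K|, abs_nonneg K, fun n => ?_⟩
  have h := (hK n).2
  rw [coeff_gf] at h
  exact h.trans (mul_le_mul_of_nonneg_right (le_abs_self K) (by positivity))

end ConnTree

/-! ### Weighted labellings -/

namespace Labelling

open Finset AndOrTree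

variable {ι : Type} [Fintype ι] {k : ℕ}

/-- The number of different variables in a labelling with literals of `k` variables. -/
def numVars (f : ι → Fin k × Bool) : ℕ := (univ.image fun i => (f i).1).card

/-- The total weight of the labellings of `n` positions with literals of `k` variables, where `w p`
is the weight of a labelling with `p` different variables. -/
noncomputable def totalWeight (w : ℕ → ℝ) (n k : ℕ) : ℝ :=
  ∑ f : Fin n → Fin k × Bool, w (numVars f)

theorem sum_eq_totalWeight [DecidableEq ι] (w : ℕ → ℝ) :
    ∑ f : ι → Fin k × Bool, w (numVars f) = totalWeight w (Fintype.card ι) k := by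
  refine Fintype.sum_equiv ((Fintype.equivFin ι).arrowCongr (Equiv.refl _)) _ _ fun f => ?_
  congr 1
  unfold numVars
  congr 1
  ext a
  simp only [mem_image, mem_univ, true_and]
  exact ((Fintype.equivFin ι).symm.surjective.exists
    (p := fun x => (f x).1 = a))

theorem totalWeight_nonneg {w : ℕ → ℝ} (hw : ∀ p, 0 ≤ w p) (n k : ℕ) : 0 ≤ totalWeight w n k :=
  sum_nonneg fun _ _ => hw _

/-- If the variable at position `j` is forced to agree with that at another position `i`, then
position `j` can be removed without changing the number of variables. -/
theorem sum_remove [DecidableEq ι] (w : ℕ → ℝ) {i j : ι} (hij : i ≠ j)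
    {φ : Fin k × Bool → Fin k × Bool} (hφ : ∀ a, (φ a).1 = a.1)
    (Q : ({x : ι // x ≠ j} → Fin k × Bool) → Prop) [DecidablePred Q] :
    ∑ f : ι → Fin k × Bool with f j = φ (f i) ∧ Q fun x => f x, w (numVars f) =
      ∑ g : {x : ι // x ≠ j} → Fin k × Bool with Q g, w (numVars g) := by
  refine sum_nbij' (fun f x => f x) (fun g x => if h : x = j then φ (g ⟨i, hij⟩) else g ⟨x, h⟩)
    ?_ ?_ ?_ ?_ ?_
  · intro f hf
    simp only [mem_filter, mem_univ, true_and] at hf ⊢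
    exact hf.2
  · intro g hg
    simp only [mem_filter, mem_univ, true_and] at hg ⊢
    refine ⟨by simp [hij], ?_⟩
    convert hg using 1
    ext1 x
    simp [x.2]
  · intro f hf
    simp only [mem_filter, mem_univ, true_and] at hf
    ext1 x
    by_cases h : x = j
    · simp [h, hf.1]
    · simp [h]
  · intro g _
    ext1 x
    simp [x.2]
  · intro f hf
    simp only [mem_filter, mem_univ, true_and] at hf
    congr 1
    unfold numVars
    congr 1
    ext a
    simp only [mem_image, mem_univ, true_and]
    constructor
    · rintro ⟨x, rfl⟩
      by_cases h : x = j
      · exact ⟨⟨i, hij⟩, by rw [h, hf.1, hφ]⟩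
      · exact ⟨⟨x, h⟩, rfl⟩
    · rintro ⟨x, rfl⟩
      exact ⟨x, rfl⟩

theorem card_ne [DecidableEq ι] (j : ι) : Fintype.card {x : ι // x ≠ j} = Fintype.card ι - 1 := by
  rw [Fintype.card_subtype_compl, Fintype.card_subtype_eq]

/-- The negation of a literal. -/
def neg (a : Fin k × Bool) : Fin k × Bool := (a.1, !a.2)

theorem fst_eq_iff (a b : Fin k × Bool) : a.1 = b.1 ↔ b = a ∨ b = neg a := by
  obtain ⟨a, x⟩ := a
  obtain ⟨b, y⟩ := b
  cases x <;> cases y <;> simp [neg, eq_comm]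

theorem eq_neg_iff (a b : Fin k × Bool) : b = neg a ↔ a.1 = b.1 ∧ a ≠ b := by
  obtain ⟨a, x⟩ := a
  obtain ⟨b, y⟩ := b
  cases x <;> cases y <;> simp [neg, eq_comm]

theorem sum_opposite [DecidableEq ι] (w : ℕ → ℝ) {i j : ι} (hij : i ≠ j) :
    ∑ f : ι → Fin k × Bool with f j = neg (f i), w (numVars f) =
      totalWeight w (Fintype.card ι - 1) k := by
  have h := sum_remove (k := k) w hij (φ := neg) (fun _ => rfl) fun _ => True
  simp only [and_true, filter_true] at h
  rw [h, sum_eq_totalWeight, card_ne]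

theorem sum_sameVar [DecidableEq ι] (w : ℕ → ℝ) {i j : ι} (hij : i ≠ j)
    (Q : ({x : ι // x ≠ j} → Fin k × Bool) → Prop) [DecidablePred Q] :
    ∑ f : ι → Fin k × Bool with (f i).1 = (f j).1 ∧ Q fun x => f x, w (numVars f) =
      2 * ∑ g : {x : ι // x ≠ j} → Fin k × Bool with Q g, w (numVars g) := by
  have h1 := sum_remove (k := k) w hij (φ := id) (fun _ => rfl) Q
  have h2 := sum_remove (k := k) w hij (φ := neg) (fun _ => rfl) Q
  have hd : Disjoint
      (univ.filter fun f : ι → Fin k × Bool => f j = id (f i) ∧ Q fun x => f x)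
      (univ.filter fun f : ι → Fin k × Bool => f j = neg (f i) ∧ Q fun x => f x) := by
    rw [disjoint_filter]
    rintro f - ⟨h, -⟩ ⟨h', -⟩
    exact ((eq_neg_iff _ _).1 h').2 h.symm
  rw [two_mul]
  nth_rewrite 1 [← h1]
  rw [← h2, ← sum_union hd]
  refine sum_congr ?_ fun _ _ => rfl
  ext f
  simp only [mem_filter, mem_univ, true_and, mem_union, fst_eq_iff, id]
  tauto

theorem sum_sameVar_pair [DecidableEq ι] (w : ℕ → ℝ) {i j : ι} (hij : i ≠ j) :
    ∑ f : ι → Fin k × Bool with (f i).1 = (f j).1, w (numVars f) =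
      2 * totalWeight w (Fintype.card ι - 1) k := by
  have h := sum_sameVar (k := k) w hij fun _ => True
  simp only [and_true, filter_true] at h
  rw [h, sum_eq_totalWeight, card_ne]

/-- Two different coincidences of variables cost two positions. -/
theorem sum_two_sameVar [DecidableEq ι] (w : ℕ → ℝ) {i j a b : ι} (hij : i ≠ j) (hab : a ≠ b)
    (h₁ : ¬(i = a ∧ j = b)) (h₂ : ¬(i = b ∧ j = a)) :
    ∑ f : ι → Fin k × Bool with (f i).1 = (f j).1 ∧ (f a).1 = (f b).1, w (numVars f) =
      4 * totalWeight w (Fintype.card ι - 2) k := by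
  have key : ∀ c d : ι, c ≠ j → d ≠ j → c ≠ d →
      ∑ f : ι → Fin k × Bool with (f i).1 = (f j).1 ∧ (f c).1 = (f d).1, w (numVars f) =
        4 * totalWeight w (Fintype.card ι - 2) k := by
    intro c d hc hd hcd
    have h := sum_sameVar (k := k) w hij fun g => (g ⟨c, hc⟩).1 = (g ⟨d, hd⟩).1
    rw [h, sum_sameVar_pair w (by simpa using hcd), card_ne, Nat.sub_sub]
    ring
  by_cases ha : a = j
  · subst ha
    rw [← key i b hij hab.symm fun h => h₂ ⟨h, rfl⟩]
    refine sum_congr ?_ fun _ _ => rfl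
    ext f
    simp only [mem_filter, mem_univ, true_and]
    exact ⟨fun h => ⟨h.1, h.1.trans h.2⟩, fun h => ⟨h.1, h.1.symm.trans h.2⟩⟩
  · by_cases hb : b = j
    · subst hb
      rw [← key i a hij hab fun h => h₁ ⟨h, rfl⟩]
      refine sum_congr ?_ fun _ _ => rfl
      ext f
      simp only [mem_filter, mem_univ, true_and]
      exact ⟨fun h => ⟨h.1, h.1.trans h.2.symm⟩, fun h => ⟨h.1, h.2.symm.trans h.1⟩⟩
    · exact key a b ha hb hab

open Classical in
theorem sum_twoRepetitions_le [DecidableEq ι] {w : ℕ → ℝ} (hw : ∀ p, 0 ≤ w p) (P : List ι) :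
    ∑ f : ι → Fin k × Bool with TwoRepetitions (fun i => (f i).1) P, w (numVars f) ≤
      (P.length : ℝ) ^ 4 * (4 * totalWeight w (Fintype.card ι - 2) k) := by
  set D := (P.toFinset ×ˢ P.toFinset) ×ˢ (P.toFinset ×ˢ P.toFinset) with hD
  set D' := D.filter fun x => x.1.1 ≠ x.1.2 ∧ x.2.1 ≠ x.2.2 ∧
    ¬(x.1.1 = x.2.1 ∧ x.1.2 = x.2.2) ∧ ¬(x.1.1 = x.2.2 ∧ x.1.2 = x.2.1) with hD'
  have h0 : 0 ≤ 4 * totalWeight w (Fintype.card ι - 2) k :=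
    mul_nonneg (by norm_num) (totalWeight_nonneg hw _ _)
  calc _ ≤ ∑ f : ι → Fin k × Bool, ∑ x ∈ D',
        if (f x.1.1).1 = (f x.1.2).1 ∧ (f x.2.1).1 = (f x.2.2).1 then w (numVars f) else 0 := by
        rw [sum_filter]
        refine sum_le_sum fun f _ => ?_
        have hnn : ∀ x ∈ D', 0 ≤ if (f x.1.1).1 = (f x.1.2).1 ∧ (f x.2.1).1 = (f x.2.2).1 then
            w (numVars f) else 0 := fun x _ => by
          split_ifs
          · exact hw _
          · exact le_rfl
        split_ifs with hf
        · obtain ⟨i, hi, j, hj, a, ha, b, hb, hij, hab, h1, h2, h3, h4⟩ := hf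
          have hx : ((i, j), (a, b)) ∈ D' := by
            simp only [hD', hD, mem_filter, mem_product, List.mem_toFinset]
            exact ⟨⟨⟨hi, hj⟩, ha, hb⟩, hij, hab, h1, h2⟩
          refine le_trans (le_of_eq ?_) (single_le_sum hnn hx)
          rw [if_pos ⟨h3, h4⟩]
        · exact sum_nonneg hnn
    _ = ∑ x ∈ D', 4 * totalWeight w (Fintype.card ι - 2) k := by
        rw [sum_comm]
        refine sum_congr rfl fun x hx => ?_
        obtain ⟨-, h1, h2, h3, h4⟩ := mem_filter.1 hx
        rw [← sum_filter, sum_two_sameVar w h1 h2 h3 h4]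
    _ ≤ _ := by
        rw [sum_const, nsmul_eq_mul]
        refine mul_le_mul_of_nonneg_right ?_ h0
        have h1 : D'.card ≤ P.length ^ 4 := by
          refine (card_filter_le _ _).trans ?_
          rw [hD, card_product, card_product]
          have := P.toFinset_card_le
          calc _ ≤ (P.length * P.length) * (P.length * P.length) := by gcongr
            _ = _ := by ring
        exact_mod_cast h1

open Classical in
/-- The pairs of positions in `O` that carry opposite literals. -/
noncomputable def oppositePairs {α : Type} (O : Finset α) (f : α → Fin k × Bool) :
    Finset (Finset α) :=
  (O.powersetCard 2).filter fun e => ∃ i ∈ e, ∃ j ∈ e, f j = neg (f i)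

theorem mem_oppositePairs {α : Type} {O : Finset α} {f : α → Fin k × Bool} {e : Finset α} :
    e ∈ oppositePairs O f ↔ (e ⊆ O ∧ e.card = 2) ∧ ∃ i ∈ e, ∃ j ∈ e, f j = neg (f i) := by
  rw [oppositePairs, mem_filter, mem_powersetCard]

theorem card_oppositePairs_le {α : Type} (O : Finset α) (f : α → Fin k × Bool) :
    (oppositePairs O f).card ≤ O.card.choose 2 :=
  (card_filter_le _ _).trans (card_powersetCard _ _).le

/-- Each of the `choose 2` pairs of positions in `O` carries opposite literals with weight
`totalWeight w (n - 1) k`. -/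
theorem sum_card_opposite_pairs [DecidableEq ι] (w : ℕ → ℝ) (O : Finset ι) :
    ∑ f : ι → Fin k × Bool, ((oppositePairs O f).card : ℝ) * w (numVars f) =
      (O.card.choose 2 : ℝ) * totalWeight w (Fintype.card ι - 1) k := by
  classical
  have h : ∀ f : ι → Fin k × Bool,
      ((oppositePairs O f).card : ℝ) * w (numVars f) = ∑ e ∈ O.powersetCard 2,
          if ∃ i ∈ e, ∃ j ∈ e, f j = neg (f i) then w (numVars f) else 0 := by
    intro f
    rw [← sum_filter, sum_const, nsmul_eq_mul, oppositePairs]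
  rw [sum_congr rfl fun f _ => h f, sum_comm, ← card_powersetCard, ← nsmul_eq_mul, ← sum_const]
  refine sum_congr rfl fun e he => ?_
  obtain ⟨i, j, hij, rfl⟩ := card_eq_two.1 (mem_powersetCard.1 he).2
  rw [← sum_opposite w hij, ← sum_filter]
  refine sum_congr ?_ fun _ _ => rfl
  ext f
  simp only [mem_filter, mem_univ, true_and, mem_insert, mem_singleton, exists_eq_or_imp,
    exists_eq_left, eq_neg_iff]
  constructor
  · rintro ((h | h) | (h | h))
    · exact absurd rfl h
    · exact h
    · exact ⟨h.1.symm, h.2.symm⟩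
    · exact absurd rfl h
  · exact fun h => Or.inl (Or.inr h)

end Labelling

namespace Labelling

open Finset AndOrTree ConnTree

/-- A literal of one of the first `k` variables, as a literal. -/
def toLiteral {k : ℕ} (a : Fin k × Bool) : Literal := (a.1, a.2)

theorem opposite_toLiteral_iff {k : ℕ} (a b : Fin k × Bool) :
    AreOpposite (toLiteral a) (toLiteral b) ↔ b = neg a := by
  rw [eq_neg_iff]
  simp [AreOpposite, toLiteral, Prod.ext_iff, Fin.ext_iff]

theorem isSimpleTautology_map_toLiteral_iff {n k : ℕ} (q : ConnTree (Fin n))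
    (f : Fin n → Fin k × Bool) : IsSimpleTautology (q.map fun i => toLiteral (f i)) ↔
      (oppositePairs q.orLeaves.toFinset f).Nonempty := by
  rw [isSimpleTautology_map_iff]
  simp only [opposite_toLiteral_iff, Finset.Nonempty, mem_oppositePairs]
  constructor
  · rintro ⟨i, hi, j, hj, h⟩
    have hij : i ≠ j := fun e => ((eq_neg_iff _ _).1 h).2 (by rw [e])
    refine ⟨({i, j} : Finset (Fin n)), ⟨?_, card_pair hij⟩, i, by simp, j, by simp, h⟩
    simp [insert_subset_iff, hi, hj]
  · rintro ⟨e, ⟨he, -⟩, i, hi, j, hj, h⟩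
    exact ⟨i, List.mem_toFinset.1 (he hi), j, List.mem_toFinset.1 (he hj), h⟩

section

open Classical

variable {w : ℕ → ℝ} {n : ℕ} (k : ℕ) {q : ConnTree (Fin n)}

theorem card_orLeaves_toFinset (hq : q.leaves.Nodup) :
    q.orLeaves.toFinset.card = q.orLeaves.length :=
  List.toFinset_card_of_nodup (q.orLeaves_sublist_leaves.nodup hq)

theorem sum_simple_le (hw : ∀ p, 0 ≤ w p) (hq : q.leaves.Nodup) :
    ∑ f : Fin n → Fin k × Bool with IsSimpleTautology (q.map fun i => toLiteral (f i)),
      w (numVars f) ≤ (q.orLeaves.length.choose 2 : ℝ) * totalWeight w (n - 1) k := by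
  have h := sum_card_opposite_pairs (k := k) w q.orLeaves.toFinset
  rw [card_orLeaves_toFinset hq, Fintype.card_fin] at h
  rw [← h, sum_filter]
  refine sum_le_sum fun f _ => ?_
  split_ifs with hf
  · rw [isSimpleTautology_map_toLiteral_iff, ← card_pos] at hf
    exact le_mul_of_one_le_left (hw _) (by exact_mod_cast Nat.succ_le_of_lt hf)
  · exact mul_nonneg (Nat.cast_nonneg _) (hw _)

/-- The lower bound in the style of Bonferroni: the labellings counted more than once have two pairs
of opposite literals among the leaves joined to the root by disjunctions, hence two repetitions. -/
theorem le_sum_simple (hw : ∀ p, 0 ≤ w p) (hq : q.leaves.Nodup) :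
    (q.orLeaves.length.choose 2 : ℝ) * totalWeight w (n - 1) k ≤
      ∑ f : Fin n → Fin k × Bool with IsSimpleTautology (q.map fun i => toLiteral (f i)),
        w (numVars f) +
      (q.orLeaves.length.choose 2 : ℝ) *
        ∑ f : Fin n → Fin k × Bool with TwoRepetitions (fun i => (f i).1) q.widePattern,
          w (numVars f) := by
  have h := sum_card_opposite_pairs (k := k) w q.orLeaves.toFinset
  rw [card_orLeaves_toFinset hq, Fintype.card_fin] at h
  rw [← h, sum_filter, sum_filter, mul_sum, ← sum_add_distrib]
  refine sum_le_sum fun f _ => ?_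
  rw [isSimpleTautology_map_toLiteral_iff]
  set E := oppositePairs q.orLeaves.toFinset f with hE
  have hEc : E.card ≤ q.orLeaves.length.choose 2 := by
    rw [← card_orLeaves_toFinset hq]
    exact card_oppositePairs_le _ _
  have hw' := hw (numVars f)
  by_cases hone : E.card ≤ 1
  · have h1 : (E.card : ℝ) * w (numVars f) ≤ w (numVars f) :=
      mul_le_of_le_one_left hw' (by exact_mod_cast hone)
    have h2 : ¬E.Nonempty → (E.card : ℝ) * w (numVars f) = 0 := fun h => by
      simp [not_nonempty_iff_eq_empty.1 h]
    have h3 : 0 ≤ (q.orLeaves.length.choose 2 : ℝ) * w (numVars f) :=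
      mul_nonneg (Nat.cast_nonneg _) hw'
    split_ifs with h4 h5 h5
    · linarith
    · linarith
    · linarith [h2 h4]
    · linarith [h2 h4]
  · obtain ⟨e, he, e', he', hne⟩ := one_lt_card.1 (not_le.1 hone)
    have hpair : ∀ e ∈ E, ∃ i j, i ≠ j ∧ e = {i, j} ∧ i ∈ q.widePattern ∧ j ∈ q.widePattern ∧
        (f i).1 = (f j).1 := by
      intro e he
      obtain ⟨⟨hsub, hc⟩, i, hi, j, hj, h⟩ := mem_oppositePairs.1 he
      rw [eq_neg_iff] at h
      have hij : i ≠ j := fun e => h.2 (by rw [e])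
      have hs := (q.orLeaves_sublist_leftPattern.trans
        q.leftPattern_sublist_widePattern).subset
      refine ⟨i, j, hij, (eq_of_subset_of_card_le ?_ ?_).symm, hs (List.mem_toFinset.1 (hsub hi)),
        hs (List.mem_toFinset.1 (hsub hj)), h.1⟩
      · simp [insert_subset_iff, hi, hj]
      · rw [card_pair hij, hc]
    obtain ⟨i, j, hij, rfl, hi, hj, h1⟩ := hpair e he
    obtain ⟨a, b, hab, rfl, ha, hb, h2⟩ := hpair e' he'
    have htwo : TwoRepetitions (fun i => (f i).1) q.widePattern := by
      refine ⟨i, hi, j, hj, a, ha, b, hb, hij, hab, ?_, ?_, h1, h2⟩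
      · rintro ⟨rfl, rfl⟩
        exact hne rfl
      · rintro ⟨rfl, rfl⟩
        exact hne (pair_comm _ _)
    rw [if_pos htwo]
    refine (mul_le_mul_of_nonneg_right (Nat.cast_le.2 hEc) hw').trans
      (le_add_of_nonneg_left ?_)
    split_ifs
    · exact hw'
    · exact le_rfl

theorem sum_tautology_le (hw : ∀ p, 0 ≤ w p) (hq : q.leaves.Nodup) :
    ∑ f : Fin n → Fin k × Bool with IsTautology (q.map fun i => toLiteral (f i)),
      w (numVars f) ≤
      ∑ f : Fin n → Fin k × Bool with IsSimpleTautology (q.map fun i => toLiteral (f i)),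
        w (numVars f) +
      ∑ f : Fin n → Fin k × Bool with TwoRepetitions (fun i => (f i).1) q.widePattern,
        w (numVars f) := by
  rw [sum_filter, sum_filter, sum_filter, ← sum_add_distrib]
  refine sum_le_sum fun f _ => ?_
  have hw' := hw (numVars f)
  by_cases h1 : IsSimpleTautology (q.map fun i => toLiteral (f i))
  · rw [if_pos h1.isTautology, if_pos h1]
    refine le_add_of_nonneg_right ?_
    split_ifs
    · exact hw'
    · exact le_rfl
  · rw [if_neg h1]
    split_ifs with h2 h3 h3
    · simp
    · exact absurd (twoRepetitions_of_isTautology (f := fun i => toLiteral (f i)) hq h2 h1)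
        fun ⟨a, ha, b, hb, c, hc, d, hd, e1, e2, e3, e4, e5, e6⟩ => h3 ⟨a, ha, b, hb, c, hc, d, hd,
          e1, e2, e3, e4, Fin.ext e5, Fin.ext e6⟩
    · simpa using hw'
    · simp

end

/-- The tree of the given structure whose leaves are labelled from left to right by `f`; a junk
value if the number of labels is not the size. -/
noncomputable def labelled {n k : ℕ} (s : ConnTree Unit) (f : Fin n → Fin k × Bool) : AndOrTree :=
  if h : (List.ofFn fun i => toLiteral (f i)).length = s.size then
    (exists_treeStructure_eq_leaves_eq s _ h).choose
  else .leaf (0, true)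

section

variable {n k : ℕ} {s : ConnTree Unit}

theorem treeStructure_labelled (hs : s.size = n) (f : Fin n → Fin k × Bool) :
    (labelled s f).treeStructure = s := by
  have h : (List.ofFn fun i => toLiteral (f i)).length = s.size := by simp [hs]
  rw [labelled, dif_pos h]
  exact (exists_treeStructure_eq_leaves_eq s _ h).choose_spec.1

theorem leaves_labelled (hs : s.size = n) (f : Fin n → Fin k × Bool) :
    (labelled s f).leaves = List.ofFn fun i => toLiteral (f i) := by
  have h : (List.ofFn fun i => toLiteral (f i)).length = s.size := by simp [hs]
  rw [labelled, dif_pos h]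
  exact (exists_treeStructure_eq_leaves_eq s _ h).choose_spec.2

/-- The trees of a given structure are the relabellings of a tree whose leaves are labelled by
their positions. -/
theorem exists_labelled_eq_map (k : ℕ) (hs : s.size = n) : ∃ q : ConnTree (Fin n),
    q.treeStructure = s ∧ q.leaves = List.finRange n ∧
      ∀ f : Fin n → Fin k × Bool, labelled s f = q.map fun i => toLiteral (f i) := by
  obtain ⟨q, h1, h2⟩ := exists_treeStructure_eq_leaves_eq s (List.finRange n) (by simp [hs])
  refine ⟨q, h1, h2, fun f => eq_of_treeStructure_eq_of_leaves_eq ?_ ?_⟩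
  · rw [treeStructure_labelled hs, treeStructure_map, h1]
  · rw [leaves_labelled hs, leaves_map, h2, List.ofFn_eq_map]

end

open Classical in
/-- The total weight of the labelled trees of size `n` that belong to a family. -/
noncomputable def familyWeight (w : ℕ → ℝ) (n k : ℕ) (F : Set AndOrTree) : ℝ :=
  ∑ s ∈ structures n, ∑ f : Fin n → Fin k × Bool with labelled s f ∈ F, w (numVars f)

theorem familyWeight_univ (w : ℕ → ℝ) (n k : ℕ) :
    familyWeight w n k Set.univ = (structures n).card * totalWeight w n k := by
  simp [familyWeight, totalWeight]

theorem familyWeight_mono {w : ℕ → ℝ} (hw : ∀ p, 0 ≤ w p) (n k : ℕ) {F G : Set AndOrTree}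
    (h : F ⊆ G) : familyWeight w n k F ≤ familyWeight w n k G := by
  classical
  refine sum_le_sum fun s _ => sum_le_sum_of_subset_of_nonneg (fun f hf => ?_) fun _ _ _ => hw _
  simp only [mem_filter, mem_univ, true_and] at hf ⊢
  exact h hf

theorem familyWeight_simple_le {w : ℕ → ℝ} (hw : ∀ p, 0 ≤ w p) (n k : ℕ) :
    familyWeight w n k simpleTautologies ≤ orPairs n * totalWeight w (n - 1) k := by
  classical
  rw [orPairs, sum_mul]
  refine sum_le_sum fun s hs => ?_
  obtain ⟨q, rfl, h2, h3⟩ := exists_labelled_eq_map k (mem_structures.1 hs)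
  have h := sum_simple_le k hw (q := q) (h2 ▸ List.nodup_finRange n)
  rw [length_orLeaves_treeStructure]
  simp only [h3]
  exact h

/-- The weight of the trees with two repetitions in the wide pattern, which is the error term, is
small because the wide pattern has bounded moments. -/
theorem exists_familyWeight_bounds : ∃ K : ℝ, 0 ≤ K ∧ ∀ (w : ℕ → ℝ), (∀ p, 0 ≤ w p) → ∀ n k : ℕ,
    orPairs n * totalWeight w (n - 1) k ≤ familyWeight w n k simpleTautologies +
      K * (structures n).card * totalWeight w (n - 2) k ∧
    familyWeight w n k tautologies ≤ familyWeight w n k simpleTautologies +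
      K * (structures n).card * totalWeight w (n - 2) k := by
  classical
  obtain ⟨K₆, hK₆, h6⟩ := exists_sum_widePattern_pow_le 6
  obtain ⟨K₄, hK₄, h4⟩ := exists_sum_widePattern_pow_le 4
  refine ⟨4 * K₆ + 4 * K₄, by positivity, fun w hw n k => ?_⟩
  have ht := totalWeight_nonneg hw (n - 2) k
  have ha : (0 : ℝ) ≤ (structures n).card := Nat.cast_nonneg _
  have hrep : ∀ q : ConnTree (Fin n),
      ∑ f : Fin n → Fin k × Bool with TwoRepetitions (fun i => (f i).1) q.widePattern,
          w (numVars f) ≤ (q.widePattern.length : ℝ) ^ 4 * (4 * totalWeight w (n - 2) k) := by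
    intro q
    have h := sum_twoRepetitions_le (k := k) hw q.widePattern
    rwa [Fintype.card_fin] at h
  constructor
  · calc orPairs n * totalWeight w (n - 1) k
        ≤ ∑ s ∈ structures n,
          ((∑ f : Fin n → Fin k × Bool with labelled s f ∈ simpleTautologies, w (numVars f)) +
            (s.widePattern.length : ℝ) ^ 6 * (4 * totalWeight w (n - 2) k)) := by
          rw [orPairs, sum_mul]
          refine sum_le_sum fun s hs => ?_
          obtain ⟨q, rfl, h2, h3⟩ := exists_labelled_eq_map k (mem_structures.1 hs)
          have h := le_sum_simple k hw (q := q) (h2 ▸ List.nodup_finRange n)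
          rw [length_orLeaves_treeStructure, length_widePattern_treeStructure]
          simp only [h3]
          refine h.trans (add_le_add le_rfl ?_)
          have hc : (q.orLeaves.length.choose 2 : ℝ) ≤ (q.widePattern.length : ℝ) ^ 2 := by
            exact_mod_cast (Nat.choose_le_pow _ 2).trans
              (Nat.pow_le_pow_left q.length_orLeaves_le_widePattern 2)
          calc _ ≤ (q.widePattern.length : ℝ) ^ 2 *
                ((q.widePattern.length : ℝ) ^ 4 * (4 * totalWeight w (n - 2) k)) :=
                mul_le_mul hc (hrep q) (sum_nonneg fun _ _ => hw _) (by positivity)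
            _ = _ := by ring
      _ ≤ familyWeight w n k simpleTautologies +
            (K₆ * (structures n).card) * (4 * totalWeight w (n - 2) k) := by
          rw [sum_add_distrib, ← sum_mul]
          exact add_le_add le_rfl (mul_le_mul_of_nonneg_right (h6 n) (by positivity))
      _ ≤ _ := by nlinarith [mul_nonneg (mul_nonneg hK₄ ha) ht]
  · calc familyWeight w n k tautologies
        ≤ ∑ s ∈ structures n,
          ((∑ f : Fin n → Fin k × Bool with labelled s f ∈ simpleTautologies, w (numVars f)) +
            (s.widePattern.length : ℝ) ^ 4 * (4 * totalWeight w (n - 2) k)) := by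
          refine sum_le_sum fun s hs => ?_
          obtain ⟨q, rfl, h2, h3⟩ := exists_labelled_eq_map k (mem_structures.1 hs)
          have h := sum_tautology_le k hw (q := q) (h2 ▸ List.nodup_finRange n)
          rw [length_widePattern_treeStructure]
          simp only [h3]
          exact h.trans (add_le_add le_rfl (hrep q))
      _ ≤ familyWeight w n k simpleTautologies +
            (K₄ * (structures n).card) * (4 * totalWeight w (n - 2) k) := by
          rw [sum_add_distrib, ← sum_mul]
          exact add_le_add le_rfl (mul_le_mul_of_nonneg_right (h4 n) (by positivity))
      _ ≤ _ := by nlinarith [mul_nonneg (mul_nonneg hK₆ ha) ht]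

/-! ### Asymptotics for a general weight -/

/-- The asymptotics of both families for labellings with an arbitrary weight, provided that
removing a position makes the total weight smaller by a factor tending to zero. -/
theorem isEquivalent_of_totalWeight {k : ℕ → ℕ} {w : ℕ → ℕ → ℝ} (hw : ∀ m p, 0 ≤ w m p)
    (hpos : ∀ᶠ n in atTop, 0 < totalWeight (w (k n)) n (k n))
    (hpos' : ∀ᶠ n in atTop, 0 < totalWeight (w (k n)) (n - 1) (k n))
    (hlim : Tendsto (fun n => totalWeight (w (k n)) (n - 2) (k n) /
      totalWeight (w (k n)) (n - 1) (k n)) atTop (nhds 0))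
    {μS μT rat : ℕ → ℝ}
    (hS : ∀ᶠ n in atTop, μS n = familyWeight (w (k n)) n (k n) simpleTautologies /
      familyWeight (w (k n)) n (k n) Set.univ)
    (hT : ∀ᶠ n in atTop, μT n = familyWeight (w (k n)) n (k n) tautologies /
      familyWeight (w (k n)) n (k n) Set.univ)
    (hrat : ∀ᶠ n in atTop, rat n = totalWeight (w (k n)) (n - 1) (k n) /
      totalWeight (w (k n)) n (k n)) :
    (μS ~[atTop] fun n => (3 / 2 : ℝ) * rat n) ∧ μT ~[atTop] μS := by
  obtain ⟨K, hK, hbd⟩ := exists_familyWeight_bounds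
  have hsub : simpleTautologies ⊆ tautologies := fun t ht => IsSimpleTautology.isTautology ht
  have hratpos : ∀ᶠ n in atTop, 0 < rat n := by
    filter_upwards [hpos, hpos', hrat] with n h1 h2 h3
    rw [h3]
    positivity
  have herr : Tendsto (fun n => K * (totalWeight (w (k n)) (n - 2) (k n) /
      totalWeight (w (k n)) (n - 1) (k n))) atTop (nhds 0) := by
    simpa using hlim.const_mul K
  have hquot : Tendsto (fun n => μS n / rat n) atTop (nhds (3 / 2)) := by
    have hlow := tendsto_orPairs_div.sub herr
    rw [sub_zero] at hlow
    refine tendsto_of_tendsto_of_tendsto_of_le_of_le' hlow tendsto_orPairs_div ?_ ?_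
    · filter_upwards [hpos, hpos', hrat, hS, eventually_ge_atTop 1] with n h1 h2 h3 h4 h5
      have ha := card_structures_pos h5
      rw [h3, h4, familyWeight_univ]
      have hb := (hbd (w (k n)) (hw _) n (k n)).1
      rw [div_div_div_eq, ← mul_div_assoc, div_sub_div _ _ ha.ne' h2.ne',
        div_le_div_iff₀ (by positivity) (by positivity)]
      have h0 : 0 ≤ (structures n).card * totalWeight (w (k n)) n (k n) *
          totalWeight (w (k n)) (n - 1) (k n) := by positivity
      nlinarith [mul_le_mul_of_nonneg_left hb h0]
    · filter_upwards [hpos, hpos', hrat, hS, eventually_ge_atTop 1] with n h1 h2 h3 h4 h5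
      have ha := card_structures_pos h5
      rw [h3, h4, familyWeight_univ]
      have hb := familyWeight_simple_le (hw (k n)) n (k n)
      rw [div_div_div_eq, div_le_div_iff₀ (by positivity) (by positivity)]
      have h0 : 0 ≤ (structures n).card * totalWeight (w (k n)) n (k n) := by positivity
      nlinarith [mul_le_mul_of_nonneg_left hb h0]
  have hSequiv : μS ~[atTop] fun n => (3 / 2 : ℝ) * rat n := by
    refine isEquivalent_of_tendsto_one ?_
    have h := hquot.const_mul (2 / 3)
    rw [show (2 / 3 : ℝ) * (3 / 2) = 1 by norm_num] at h
    refine h.congr' ?_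
    filter_upwards [hratpos] with n hn
    simp only [Pi.div_apply]
    field_simp
  refine ⟨hSequiv, ?_⟩
  have hdiff : (μT - μS) =o[atTop] rat := by
    refine (isLittleO_iff_tendsto' ?_).2 ?_
    · filter_upwards [hratpos] with n hn h0
      exact absurd h0 hn.ne'
    · refine squeeze_zero' ?_ ?_ herr
      · filter_upwards [hpos, hratpos, hS, hT, eventually_ge_atTop 1] with n h1 h2 h3 h4 h5
        have ha := card_structures_pos h5
        have hm := familyWeight_mono (hw (k n)) n (k n) hsub
        rw [Pi.sub_apply, h3, h4, ← sub_div, familyWeight_univ]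
        have := sub_nonneg.2 hm
        positivity
      · filter_upwards [hpos, hpos', hrat, hS, hT, eventually_ge_atTop 1] with n h1 h2 h3 h4 h5 h6
        have ha := card_structures_pos h6
        have hb := (hbd (w (k n)) (hw _) n (k n)).2
        rw [Pi.sub_apply, h3, h4, h5, ← sub_div, familyWeight_univ, div_div_div_eq,
          ← mul_div_assoc, div_le_div_iff₀ (by positivity) (by positivity)]
        have h0 : 0 ≤ totalWeight (w (k n)) n (k n) * totalWeight (w (k n)) (n - 1) (k n) := by
          positivity
        nlinarith [mul_le_mul_of_nonneg_left hb h0]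
  have hO : rat =O[atTop] μS := by
    have h := hSequiv.symm.isBigO
    exact (isBigO_const_mul_self (2 / 3 : ℝ) (fun n => (3 / 2 : ℝ) * rat n) atTop |>.congr_left
      fun n => by ring).trans h
  exact hdiff.trans_isBigO hO

end Labelling

/-! ### The generalised model -/

namespace Labelling

open Finset AndOrTree ConnTree

theorem toLiteral_injective {k : ℕ} : Function.Injective (toLiteral (k := k)) := fun a b h => by
  simpa [toLiteral, Prod.ext_iff, Fin.ext_iff] using h

theorem labelled_injective {n k : ℕ} {s s' : ConnTree Unit} (hs : s.size = n) (hs' : s'.size = n)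
    {f f' : Fin n → Fin k × Bool} (h : labelled s f = labelled s' f') : s = s' ∧ f = f' := by
  refine ⟨?_, ?_⟩
  · rw [← treeStructure_labelled hs f, h, treeStructure_labelled hs']
  · have h1 := congrArg ConnTree.leaves h
    rw [leaves_labelled hs, leaves_labelled hs'] at h1
    have h2 := List.ofFn_injective h1
    exact funext fun i => toLiteral_injective (congrFun h2 i)

theorem mem_treesG_iff {n k : ℕ} {t : AndOrTree} : t ∈ treesG n k ↔
    ∃ s ∈ structures n, ∃ f : Fin n → Fin k × Bool, labelled s f = t := by
  constructor
  · rintro ⟨h1, h2⟩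
    refine ⟨t.treeStructure, mem_structures.2 ((size_treeStructure t).trans h1),
      fun i => (⟨(t.leaves[i]'(h1 ▸ i.2)).1, h2 _ (List.getElem_mem _)⟩,
        (t.leaves[i]'(h1 ▸ i.2)).2), ?_⟩
    refine eq_of_treeStructure_eq_of_leaves_eq ?_ ?_
    · rw [treeStructure_labelled ((size_treeStructure t).trans h1)]
    · rw [leaves_labelled ((size_treeStructure t).trans h1)]
      refine List.ext_getElem (by simpa [size] using h1.symm) fun i _ _ => ?_
      simp [toLiteral]
  · rintro ⟨s, hs, f, rfl⟩
    have h := leaves_labelled (mem_structures.1 hs) f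
    refine ⟨by simp [size, h], fun a ha => ?_⟩
    rw [h, List.mem_ofFn] at ha
    obtain ⟨i, rfl⟩ := ha
    exact (f i).1.2

open Classical in
/-- The pairs of a structure and a labelling that give a tree in a family. -/
noncomputable def familyPairs (n k : ℕ) (F : Set AndOrTree) :
    Finset (ConnTree Unit × (Fin n → Fin k × Bool)) :=
  (structures n ×ˢ univ).filter fun x => labelled x.1 x.2 ∈ F

theorem mem_familyPairs {n k : ℕ} {F : Set AndOrTree}
    {x : ConnTree Unit × (Fin n → Fin k × Bool)} :
    x ∈ familyPairs n k F ↔ x.1.size = n ∧ labelled x.1 x.2 ∈ F := by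
  simp [familyPairs]

theorem familyWeight_eq_sum_familyPairs (w : ℕ → ℝ) (n k : ℕ) (F : Set AndOrTree) :
    familyWeight w n k F = ∑ x ∈ familyPairs n k F, w (numVars x.2) := by
  classical
  simp only [familyWeight, familyPairs, sum_filter, sum_product]

theorem ncard_inter_treesG (n k : ℕ) (F : Set AndOrTree) :
    ((F ∩ treesG n k).ncard : ℝ) = familyWeight (fun _ => 1) n k F := by
  classical
  have hinj : Set.InjOn (fun x : ConnTree Unit × (Fin n → Fin k × Bool) => labelled x.1 x.2)
      (familyPairs n k F) := by
    rintro x hx y hy h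
    have h := labelled_injective (mem_familyPairs.1 hx).1 (mem_familyPairs.1 hy).1 h
    exact Prod.ext h.1 h.2
  have himg : F ∩ treesG n k =
      ((familyPairs n k F).image fun x => labelled x.1 x.2 : Finset AndOrTree) := by
    ext t
    simp only [Set.mem_inter_iff, mem_treesG_iff, coe_image, Set.mem_image, mem_coe,
      mem_familyPairs, Prod.exists, mem_structures]
    constructor
    · rintro ⟨h, s, hs, f, rfl⟩
      exact ⟨s, f, ⟨hs, h⟩, rfl⟩
    · rintro ⟨s, f, ⟨hs, h⟩, rfl⟩
      exact ⟨h, s, hs, f, rfl⟩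
  rw [himg, Set.ncard_coe_finset, card_image_of_injOn hinj, familyWeight_eq_sum_familyPairs]
  simp

theorem totalWeight_one (n k : ℕ) : totalWeight (fun _ => 1) n k = labG n k := by
  simp [totalWeight, labG, mul_comm]

theorem muG_eq (k : ℕ → ℕ) (F : Set AndOrTree) (n : ℕ) :
    muG k F n = familyWeight (fun _ => 1) n (k n) F /
      familyWeight (fun _ => 1) n (k n) Set.univ := by
  rw [muG, ncard_inter_treesG, ← ncard_inter_treesG n (k n) Set.univ, Set.univ_inter]

theorem isEquivalent_muG {k : ℕ → ℕ} (hk : Tendsto k atTop atTop) :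
    (muG k simpleTautologies ~[atTop] fun n => (3 / 2 : ℝ) * ratG k n) ∧
      muG k tautologies ~[atTop] muG k simpleTautologies := by
  have hpos : ∀ᶠ n in atTop, (0 : ℝ) < 2 * (k n : ℝ) := by
    filter_upwards [hk.eventually_ge_atTop 1] with n hn
    have : (1 : ℝ) ≤ k n := by exact_mod_cast hn
    linarith
  refine isEquivalent_of_totalWeight (w := fun _ _ => 1) (fun _ _ => zero_le_one) ?_ ?_ ?_
    (.of_forall fun n => muG_eq k _ n) (.of_forall fun n => muG_eq k _ n) ?_
  · filter_upwards [hpos] with n hn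
    rw [totalWeight_one]
    exact pow_pos hn _
  · filter_upwards [hpos] with n hn
    rw [totalWeight_one]
    exact pow_pos hn _
  · have h : Tendsto (fun n => (2 * (k n : ℝ))⁻¹) atTop (nhds 0) :=
      tendsto_inv_atTop_zero.comp
        ((tendsto_natCast_atTop_atTop.comp hk).const_mul_atTop (by norm_num : (0 : ℝ) < 2))
    refine h.congr' ?_
    filter_upwards [hpos, eventually_ge_atTop 2] with n hn h2
    obtain ⟨m, rfl⟩ := Nat.exists_eq_add_of_le' h2
    rw [totalWeight_one, totalWeight_one, labG, labG, Nat.add_sub_cancel,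
      show m + 2 - 1 = m + 1 by omega, pow_succ]
    field_simp
  · filter_upwards with n
    rw [totalWeight_one, totalWeight_one, ratG]

/-! ### Stirling numbers and the number of different variables -/

theorem numVars_le {n k : ℕ} (f : Fin n → Fin k × Bool) : numVars f ≤ k :=
  (card_le_univ _).trans (Fintype.card_fin k).le

theorem numVars_cons {n k : ℕ} (a : Fin k × Bool) (f : Fin n → Fin k × Bool) :
    numVars (Fin.cons a f : Fin (n + 1) → Fin k × Bool) =
      if a.1 ∈ univ.image fun i => (f i).1 then numVars f else numVars f + 1 := by
  have h : (univ.image fun i => ((Fin.cons a f : Fin (n + 1) → Fin k × Bool) i).1) =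
      insert a.1 (univ.image fun i => (f i).1) := by
    ext v
    simp [Fin.exists_fin_succ, eq_comm]
  rw [numVars, h]
  split_ifs with ha
  · rw [insert_eq_of_mem ha, numVars]
  · rw [card_insert_of_notMem ha, numVars]

theorem sum_numVars_succ (n k : ℕ) (g : ℕ → ℝ) :
    ∑ f : Fin (n + 1) → Fin k × Bool, g (numVars f) = ∑ f : Fin n → Fin k × Bool,
      (2 * (numVars f * g (numVars f)) + 2 * ((k - numVars f : ℝ) * g (numVars f + 1))) := by
  have h0 : ∑ f : Fin (n + 1) → Fin k × Bool, g (numVars f) =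
      ∑ f : Fin n → Fin k × Bool, ∑ v : Fin k, ∑ b : Bool,
        g (numVars (Fin.cons (v, b) f : Fin (n + 1) → Fin k × Bool)) := by
    simp only [← Fintype.sum_prod_type' (f := fun (v : Fin k) (b : Bool) =>
      g (numVars (Fin.cons (v, b) _ : Fin (n + 1) → Fin k × Bool)))]
    rw [sum_comm, ← Fintype.sum_prod_type']
    exact ((Fin.consEquiv fun _ : Fin (n + 1) => Fin k × Bool).sum_comp _).symm
  rw [h0]
  refine sum_congr rfl fun f _ => ?_
  have h : ∀ v : Fin k, ∑ b : Bool, g (numVars (Fin.cons (v, b) f : Fin (n + 1) → Fin k × Bool)) =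
      2 * if v ∈ univ.image fun i => (f i).1 then g (numVars f) else g (numVars f + 1) := by
    intro v
    rw [Fintype.sum_bool, numVars_cons, numVars_cons]
    by_cases hv : v ∈ univ.image fun i => (f i).1
    · simp only [if_pos hv, two_mul]
    · simp only [if_neg hv, two_mul]
  rw [sum_congr rfl fun v _ => h v, ← mul_sum, ← mul_add, sum_ite, sum_const, sum_const,
    nsmul_eq_mul, nsmul_eq_mul]
  congr 2
  · rw [filter_mem_eq_inter, univ_inter, numVars]
  · rw [filter_not, filter_mem_eq_inter, univ_inter, card_sdiff_of_subset (subset_univ _),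
      card_univ, Fintype.card_fin, ← numVars, Nat.cast_sub (numVars_le f)]

/-- There are `2 ^ n * k.descFactorial p * S(n, p)` labellings of `n` positions with `p` different
variables. -/
theorem sum_numVars (n k : ℕ) (g : ℕ → ℝ) :
    ∑ f : Fin n → Fin k × Bool, g (numVars f) =
      2 ^ n * ∑ p ∈ range (n + 1), (k.descFactorial p : ℝ) * Nat.stirlingSecond n p * g p := by
  induction n generalizing g with
  | zero => simp [numVars]
  | succ n ih =>
    rw [sum_numVars_succ, ih fun p => 2 * (p * g p) + 2 * ((k - p : ℝ) * g (p + 1)),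
      sum_range_succ' _ (n + 1)]
    have hdesc : ∀ p, (k.descFactorial (p + 1) : ℝ) = (k - p : ℝ) * k.descFactorial p := by
      intro p
      rw [Nat.descFactorial_succ]
      push_cast
      rcases le_or_gt p k with h | h
      · rw [Nat.cast_sub h]
      · rw [Nat.descFactorial_of_lt h]; simp
    have h1 : ∑ p ∈ range (n + 1), (k.descFactorial p : ℝ) * Nat.stirlingSecond n p * (p * g p) =
        ∑ p ∈ range (n + 1), (k.descFactorial (p + 1) : ℝ) * Nat.stirlingSecond n (p + 1) *
          ((p + 1 : ℕ) * g (p + 1)) := by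
      have h2 := sum_range_succ' (fun p => (k.descFactorial p : ℝ) * Nat.stirlingSecond n p *
        (p * g p)) (n + 1)
      rw [sum_range_succ, Nat.stirlingSecond_eq_zero_of_lt (Nat.lt_succ_self n)] at h2
      simpa using h2
    simp only [Nat.stirlingSecond_succ_zero, Nat.stirlingSecond_succ_succ, Nat.cast_zero, mul_zero,
      zero_mul, add_zero, mul_add, sum_add_distrib]
    have h3 : ∑ p ∈ range (n + 1), (k.descFactorial p : ℝ) * Nat.stirlingSecond n p *
        (2 * (p * g p)) = 2 * ∑ p ∈ range (n + 1),
          (k.descFactorial p : ℝ) * Nat.stirlingSecond n p * (p * g p) := by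
      rw [mul_sum]
      exact sum_congr rfl fun _ _ => by ring
    rw [h3, h1, pow_succ, mul_assoc, ← mul_add]
    congr 1
    rw [mul_sum, mul_sum, ← sum_add_distrib]
    refine sum_congr rfl fun p _ => ?_
    rw [hdesc]
    push_cast
    ring

theorem stirlingSecond_le_pow (n p : ℕ) : (Nat.stirlingSecond n p : ℝ) ≤ (p : ℝ) ^ n := by
  rcases lt_or_ge n p with h | h
  · rw [Nat.stirlingSecond_eq_zero_of_lt h]
    simp
  · have h1 := sum_numVars n p fun _ => 1
    simp only [mul_one] at h1
    have h2 : ∑ f : Fin n → Fin p × Bool, (1 : ℝ) = 2 ^ n * (p : ℝ) ^ n := by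
      simp [mul_pow, mul_comm]
    rw [h2] at h1
    rw [mul_left_cancel₀ (by positivity) h1]
    refine le_trans ?_ (single_le_sum
      (f := fun q => (p.descFactorial q : ℝ) * Nat.stirlingSecond n q) (fun q _ => by positivity)
      (mem_range.2 (Nat.lt_succ_of_le h)))
    refine le_mul_of_one_le_left (Nat.cast_nonneg _) ?_
    rw [Nat.descFactorial_self]
    exact_mod_cast Nat.succ_le_of_lt p.factorial_pos

theorem pow_le_stirlingSecond (q m : ℕ) : q ^ m ≤ Nat.stirlingSecond (q + m) q := by
  induction m with
  | zero => simp [Nat.stirlingSecond_self]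
  | succ m ih =>
    cases q with
    | zero => simp
    | succ q =>
      rw [← add_assoc, Nat.stirlingSecond_succ_succ, pow_succ, mul_comm]
      exact (Nat.mul_le_mul_left _ ih).trans (Nat.le_add_right _ _)

theorem labE_pos {n m : ℕ} (hn : 1 ≤ n) (hm : 1 ≤ m) : 0 < labE n m := by
  obtain ⟨n, rfl⟩ := Nat.exists_eq_add_of_le' hn
  refine mul_pos (by positivity) (sum_pos' (fun p _ => by positivity)
    ⟨1, mem_Icc.2 ⟨le_rfl, hm⟩, ?_⟩)
  rw [Nat.stirlingSecond_one_right]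
  positivity

/-- Uniformly in the number of variables, an additional position increases `labE` by an arbitrarily
large factor: the terms with few blocks are negligible, and a partition with `p` blocks can be
extended in at least `p` ways. -/
theorem exists_mul_labE_le (P : ℕ) : ∃ N : ℕ, ∀ n ≥ N, ∀ m ≥ N,
    (P : ℝ) * labE n m ≤ labE (n + 1) m := by
  have hlim : Tendsto (fun n : ℕ => (P : ℝ) * P * (2 * (P + 1)) ^ (P + 1) *
      ((P : ℝ) / (P + 1)) ^ n) atTop (nhds 0) := by
    have h := (tendsto_pow_atTop_nhds_zero_of_lt_one (r := (P : ℝ) / (P + 1)) (by positivity)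
      (by rw [div_lt_one (by positivity)]; linarith)).const_mul
      ((P : ℝ) * P * (2 * (P + 1)) ^ (P + 1))
    simpa using h
  obtain ⟨N, hN⟩ := eventually_atTop.1 (hlim.eventually_le_const zero_lt_one)
  refine ⟨N + P + 1, fun n hn m hm => ?_⟩
  set x : ℕ → ℝ := fun p => (Nat.stirlingSecond n p : ℝ) * (2 ^ p)⁻¹ with hx
  have hx0 : ∀ p, 0 ≤ x p := fun p => by positivity
  have hsmall : ∀ p ≤ P, x p ≤ (P : ℝ) ^ n := fun p hp => by
    refine (mul_le_of_le_one_right (Nat.cast_nonneg _)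
      (inv_le_one_of_one_le₀ (one_le_pow₀ one_le_two))).trans ?_
    refine (stirlingSecond_le_pow n p).trans ?_
    have : (p : ℝ) ≤ P := by exact_mod_cast hp
    gcongr
  have hbig : (P : ℝ) * P * P ^ n ≤ x (P + 1) := by
    have h1 := hN n (by omega)
    have h2 : ((P + 1 : ℕ) : ℝ) ^ (n - (P + 1)) ≤ Nat.stirlingSecond n (P + 1) := by
      have h := pow_le_stirlingSecond (P + 1) (n - (P + 1))
      rw [Nat.add_sub_cancel' (by omega)] at h
      exact_mod_cast h
    have h3 : ((P : ℝ) + 1) ^ n = (P + 1) ^ (n - (P + 1)) * (P + 1) ^ (P + 1) := by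
      rw [← pow_add, Nat.sub_add_cancel (by omega)]
    rw [div_pow, ← mul_div_assoc, div_le_one (by positivity), h3, mul_pow] at h1
    rw [hx]
    simp only
    rw [← div_eq_mul_inv, le_div_iff₀ (by positivity)]
    push_cast at h2
    refine le_trans ?_ h2
    have h4 : (0 : ℝ) < (P + 1) ^ (P + 1) := by positivity
    refine le_of_mul_le_mul_right ?_ h4
    linarith
  have hsum : (P : ℝ) * ∑ p ∈ Icc 1 m, x p ≤ ∑ p ∈ Icc 1 m, 2 * (p * x p) := by
    have hpt : ∀ p ∈ Icc 1 m, (P : ℝ) * x p ≤ 2 * (p * x p) + (if p ≤ P then P * x p else 0) -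
        if p = P + 1 then x p else 0 := by
      intro p _
      have hp0 : 0 ≤ (p : ℝ) * x p := mul_nonneg (Nat.cast_nonneg _) (hx0 p)
      rcases lt_or_ge P p with h | h
      · have h1 : (P : ℝ) + 1 ≤ p := by exact_mod_cast h
        have h2 := mul_le_mul_of_nonneg_right h1 (hx0 p)
        rw [if_neg (by omega)]
        split_ifs <;> nlinarith [hx0 p]
      · rw [if_pos h, if_neg (by omega)]
        linarith
    rw [mul_sum]
    refine (sum_le_sum hpt).trans ?_
    rw [sum_sub_distrib, sum_add_distrib, sum_ite_eq' (Icc 1 m) (P + 1),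
      if_pos (mem_Icc.2 ⟨by omega, by omega⟩), ← sum_filter]
    have h1 : ∑ p ∈ (Icc 1 m).filter (· ≤ P), (P : ℝ) * x p ≤ P * P * P ^ n := by
      calc _ ≤ ∑ p ∈ (Icc 1 m).filter (· ≤ P), (P : ℝ) * P ^ n :=
            sum_le_sum fun p hp =>
              mul_le_mul_of_nonneg_left (hsmall p (mem_filter.1 hp).2) (Nat.cast_nonneg _)
        _ ≤ P * (P * P ^ n) := by
            rw [sum_const, nsmul_eq_mul]
            refine mul_le_mul_of_nonneg_right ?_ (by positivity)
            have : ((Icc 1 m).filter (· ≤ P)).card ≤ (Icc 1 P).card := card_le_card fun p hp => by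
              simp only [mem_filter, mem_Icc] at hp ⊢
              omega
            rw [Nat.card_Icc, Nat.add_sub_cancel] at this
            exact_mod_cast this
        _ = _ := by ring
    linarith
  have hstep : ∑ p ∈ Icc 1 m, (p : ℝ) * x p ≤
      ∑ p ∈ Icc 1 m, (Nat.stirlingSecond (n + 1) p : ℝ) * (2 ^ p)⁻¹ := by
    refine sum_le_sum fun p hp => ?_
    obtain ⟨q, rfl⟩ := Nat.exists_eq_add_of_le' (mem_Icc.1 hp).1
    rw [hx]
    simp only
    rw [← mul_assoc, Nat.stirlingSecond_succ_succ]
    refine mul_le_mul_of_nonneg_right ?_ (by positivity)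
    exact_mod_cast Nat.le_add_right _ _
  rw [← mul_sum] at hsum
  calc (P : ℝ) * labE n m = 2 ^ n * (P * ∑ p ∈ Icc 1 m, x p) := by rw [labE]; ring
    _ ≤ 2 ^ n * (2 * ∑ p ∈ Icc 1 m, (Nat.stirlingSecond (n + 1) p : ℝ) * (2 ^ p)⁻¹) := by
        refine mul_le_mul_of_nonneg_left (hsum.trans ?_) (by positivity)
        exact mul_le_mul_of_nonneg_left hstep (by norm_num)
    _ = labE (n + 1) m := by rw [labE]; ring

/-- The reciprocal of the number of labellings with literals of `k` variables that are equivalent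
to a given one with `p` different variables. -/
noncomputable def classWeight (k p : ℕ) : ℝ := ((k.descFactorial p : ℝ) * 2 ^ p)⁻¹

theorem totalWeight_classWeight {n : ℕ} (hn : 1 ≤ n) (k : ℕ) :
    totalWeight (classWeight k) n k = labE n k := by
  obtain ⟨n, rfl⟩ := Nat.exists_eq_add_of_le' hn
  rw [totalWeight, sum_numVars, labE]
  congr 1
  set h : ℕ → ℝ := fun p => if p ∈ Icc 1 k then
    (Nat.stirlingSecond (n + 1) p : ℝ) * (2 ^ p)⁻¹ else 0 with hh
  have h1 : ∑ p ∈ range (n + 1 + 1), (k.descFactorial p : ℝ) * Nat.stirlingSecond (n + 1) p *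
      classWeight k p = ∑ p ∈ range (n + 1 + 1), h p := by
    refine sum_congr rfl fun p _ => ?_
    rw [hh]
    simp only
    split_ifs with hp
    · have : (k.descFactorial p : ℝ) ≠ 0 := by
        rw [Nat.cast_ne_zero, ne_eq, Nat.descFactorial_eq_zero_iff_lt]
        have := (mem_Icc.1 hp).2
        omega
      rw [classWeight]
      field_simp
    · rw [mem_Icc, not_and_or] at hp
      rcases hp with hp | hp
      · rw [show p = 0 by omega, Nat.stirlingSecond_succ_zero]
        simp
      · rw [Nat.descFactorial_of_lt (by omega)]
        simp
  have h2 : ∑ p ∈ Icc 1 k, (Nat.stirlingSecond (n + 1) p : ℝ) * (2 ^ p)⁻¹ =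
      ∑ p ∈ Icc 1 k, h p := sum_congr rfl fun p hp => by rw [hh]; simp only; rw [if_pos hp]
  rw [h1, h2]
  trans ∑ p ∈ range (n + k + 2), h p
  · refine sum_subset (range_subset_range.2 (by omega)) fun p _ hp => ?_
    rw [hh]
    simp only
    rw [Nat.stirlingSecond_eq_zero_of_lt (by simpa [Nat.succ_le_iff] using hp)]
    simp
  · refine (sum_subset (fun p hp => ?_) fun p _ hp => ?_).symm
    · rw [mem_Icc] at hp
      exact mem_range.2 (by omega)
    · rw [hh]
      simp only
      rw [if_neg hp]

theorem tendsto_labE_div {k : ℕ → ℕ} (hk : Tendsto k atTop atTop) :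
    Tendsto (fun n => labE (n - 2) (k n) / labE (n - 1) (k n)) atTop (nhds 0) := by
  rw [Metric.tendsto_atTop]
  intro ε hε
  obtain ⟨P, hP⟩ := exists_nat_gt (1 / ε)
  obtain ⟨N, hN⟩ := exists_mul_labE_le P
  refine eventually_atTop.1 ?_
  filter_upwards [eventually_ge_atTop (N + 3), hk.eventually_ge_atTop (N + 1)] with n hn hkn
  have h := hN (n - 2) (by omega) (k n) (by omega)
  rw [show n - 2 + 1 = n - 1 by omega] at h
  have h1 : 0 < labE (n - 2) (k n) := labE_pos (by omega) (by omega)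
  have h2 : 0 < labE (n - 1) (k n) := labE_pos (by omega) (by omega)
  rw [Real.dist_eq, sub_zero, abs_of_pos (div_pos h1 h2), div_lt_iff₀ h2]
  rw [div_lt_iff₀ hε] at hP
  nlinarith [mul_le_mul_of_nonneg_left h hε.le]

end Labelling

/-! ### Equivalence classes -/

namespace Labelling

open Finset AndOrTree ConnTree

/-- Two labellings are of the same type if they have the same coincidences of variables and of
literals. -/
def SameType {ι κ κ' : Type} (f : ι → κ × Bool) (g : ι → κ' × Bool) : Prop :=
  ∀ i j, ((f i).1 = (f j).1 ↔ (g i).1 = (g j).1) ∧ (f i = f j ↔ g i = g j)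

theorem SameType.xor_eq {ι κ κ' : Type} {f : ι → κ × Bool} {g : ι → κ' × Bool}
    (h : SameType f g) {i j : ι} (hij : (f i).1 = (f j).1) :
    xor (g i).2 (f i).2 = xor (g j).2 (f j).2 := by
  have h1 := (h i j).1.1 hij
  have h2 := (h i j).2
  rw [Prod.ext_iff, Prod.ext_iff] at h2
  simp only [hij, h1, true_and] at h2
  revert h2
  cases (f i).2 <;> cases (f j).2 <;> cases (g i).2 <;> cases (g j).2 <;> simp

theorem equivalent_map_iff {n : ℕ} {q : ConnTree (Fin n)} (hq : q.leaves = List.finRange n)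
    (f g : Fin n → Literal) : Equivalent (q.map f) (q.map g) ↔ SameType f g := by
  have hl : ∀ f : Fin n → Literal, (q.map f).leaves = List.ofFn f := fun f => by
    rw [leaves_map, hq, List.ofFn_eq_map]
  have hs : (q.map f).size = n := by simp [size, hl]
  simp only [Equivalent, treeStructure_map, true_and, hs, hl, List.map_ofFn]
  constructor
  · rintro ⟨h1, h2⟩ i j
    have h1 := h1 i i.2 j j.2
    have h2 := h2 i i.2 j j.2
    simp only [List.getElem?_ofFn, Fin.is_lt, dite_true, Option.some.injEq, Fin.eta,
      Function.comp] at h1 h2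
    exact ⟨h1, h2⟩
  · intro h
    refine ⟨fun i hi j hj => ?_, fun i hi j hj => ?_⟩
    · simpa [List.getElem?_ofFn, hi, hj] using (h ⟨i, hi⟩ ⟨j, hj⟩).1
    · simpa [List.getElem?_ofFn, hi, hj] using (h ⟨i, hi⟩ ⟨j, hj⟩).2

/-- Two trees of the same structure are relabellings of the same tree of positions. -/
theorem exists_eq_map {t t' : AndOrTree} (h : t.treeStructure = t'.treeStructure) :
    ∃ (q : ConnTree (Fin t.size)) (f g : Fin t.size → Literal),
      q.leaves = List.finRange t.size ∧ t = q.map f ∧ t' = q.map g := by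
  obtain ⟨q, h1, h2⟩ := exists_treeStructure_eq_leaves_eq t.treeStructure
    (List.finRange t.size) (by simp [size_treeStructure])
  have key : ∀ u : AndOrTree, u.treeStructure = t.treeStructure →
      ∃ f : Fin t.size → Literal, u = q.map f := by
    intro u hu
    have hsz : u.leaves.length = t.size := size_eq_of_treeStructure_eq hu
    refine ⟨fun i => u.leaves[i]'(hsz.symm ▸ i.2),
      eq_of_treeStructure_eq_of_leaves_eq ?_ ?_⟩
    · rw [treeStructure_map, h1, hu]
    · rw [leaves_map, h2, ← List.ofFn_eq_map]
      refine List.ext_getElem (by simp [hsz]) fun i _ _ => ?_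
      simp
  obtain ⟨f, hf⟩ := key t rfl
  obtain ⟨g, hg⟩ := key t' h.symm
  exact ⟨q, f, g, h2, hf, hg⟩

theorem isTautology_of_equivalent {t t' : AndOrTree} (h : Equivalent t t') (ht : t.IsTautology) :
    t'.IsTautology := by
  classical
  obtain ⟨q, f, g, hq, h1, h2⟩ := exists_eq_map h.1
  rw [h1, h2, equivalent_map_iff hq] at h
  rw [h1] at ht
  rw [h2]
  intro x
  -- The assignment of the old variables under which every leaf keeps its truth value.
  set y : ℕ → Bool := fun v => if hv : ∃ i, (f i).1 = v then
    xor (x (g hv.choose).1) (xor (g hv.choose).2 (f hv.choose).2) else true with hy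
  have hxy : litTruth x ∘ g = litTruth y ∘ f := by
    funext i
    have hv : ∃ j, (f j).1 = (f i).1 := ⟨i, rfl⟩
    have e1 : y (f i).1 = xor (x (g i).1) (xor (g i).2 (f i).2) := by
      rw [hy]
      simp only
      rw [dif_pos hv, h.xor_eq hv.choose_spec, (h _ _).1.1 hv.choose_spec]
    simp only [Function.comp, litTruth, e1]
    cases x (g i).1 <;> cases (g i).2 <;> cases (f i).2 <;> rfl
  have h3 := ht y
  rwa [eval_eq_truth, truth_map, ← hxy, ← truth_map, ← eval_eq_truth] at h3

theorem isSimpleTautology_of_equivalent {t t' : AndOrTree} (h : Equivalent t t')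
    (ht : t.IsSimpleTautology) : t'.IsSimpleTautology := by
  obtain ⟨q, f, g, hq, h1, h2⟩ := exists_eq_map h.1
  rw [h1, h2, equivalent_map_iff hq] at h
  rw [h1, isSimpleTautology_map_iff] at ht
  rw [h2, isSimpleTautology_map_iff]
  obtain ⟨i, hi, j, hj, h3, h4⟩ := ht
  exact ⟨i, hi, j, hj, (h i j).1.1 h3, fun e => h4 ((h i j).2.2 e)⟩

/-- The labellings of the type of `f` are obtained by injectively renaming its variables and
negating an arbitrary set of them. -/
theorem sameType_iff_exists {n k : ℕ} (f g : Fin n → Fin k × Bool) :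
    SameType f g ↔ ∃ (e : {v // v ∈ univ.image fun i => (f i).1} ↪ Fin k)
      (σ : {v // v ∈ univ.image fun i => (f i).1} → Bool),
      (fun i => (e ⟨(f i).1, mem_image_of_mem _ (mem_univ i)⟩,
        xor (σ ⟨(f i).1, mem_image_of_mem _ (mem_univ i)⟩) (f i).2)) = g := by
  constructor
  · intro h
    have hex : ∀ v : {v // v ∈ univ.image fun i => (f i).1}, ∃ i, (f i).1 = v := fun v => by
      obtain ⟨i, -, hi⟩ := mem_image.1 v.2
      exact ⟨i, hi⟩
    choose c hc using hex
    refine ⟨⟨fun v => (g (c v)).1, fun v v' hvv => ?_⟩,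
      fun v => xor (g (c v)).2 (f (c v)).2, funext fun i => Prod.ext ?_ ?_⟩
    · rw [Subtype.ext_iff, ← hc v, ← hc v']
      exact (h _ _).1.2 hvv
    · exact (h _ _).1.1 (hc ⟨(f i).1, _⟩)
    · simp only [h.xor_eq (hc ⟨(f i).1, mem_image_of_mem _ (mem_univ i)⟩)]
      cases (g i).2 <;> cases (f i).2 <;> rfl
  · rintro ⟨e, σ, rfl⟩ i j
    refine ⟨by simp, ?_⟩
    simp only [Prod.ext_iff, EmbeddingLike.apply_eq_iff_eq, Subtype.mk.injEq]
    refine and_congr_right fun h => ?_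
    simp only [h]
    cases σ ⟨(f j).1, mem_image_of_mem _ (mem_univ j)⟩ <;> cases (f i).2 <;> cases (f j).2 <;> simp

theorem SameType.numVars_eq {n k : ℕ} {f g : Fin n → Fin k × Bool} (h : SameType f g) :
    numVars g = numVars f := by
  obtain ⟨e, σ, rfl⟩ := (sameType_iff_exists f g).1 h
  have : (univ.image fun i => e ⟨(f i).1, mem_image_of_mem _ (mem_univ i)⟩) =
      (univ : Finset {v // v ∈ univ.image fun i => (f i).1}).map e := by
    ext v
    simp only [mem_image, mem_univ, true_and, Finset.mem_map]
    constructor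
    · rintro ⟨i, rfl⟩
      exact ⟨_, rfl⟩
    · rintro ⟨⟨a, ha⟩, rfl⟩
      obtain ⟨i, -, rfl⟩ := mem_image.1 ha
      exact ⟨i, rfl⟩
  rw [numVars, numVars, this, card_map, card_univ, Fintype.card_coe]

open Classical in
theorem card_sameType {n k : ℕ} (f : Fin n → Fin k × Bool) :
    (univ.filter fun g : Fin n → Fin k × Bool => SameType f g).card =
      k.descFactorial (numVars f) * 2 ^ numVars f := by
  set Φ : (({v // v ∈ univ.image fun i => (f i).1} ↪ Fin k) ×
      ({v // v ∈ univ.image fun i => (f i).1} → Bool)) → Fin n → Fin k × Bool :=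
    fun x i => (x.1 ⟨(f i).1, mem_image_of_mem _ (mem_univ i)⟩,
      xor (x.2 ⟨(f i).1, mem_image_of_mem _ (mem_univ i)⟩) (f i).2) with hΦ
  have himg : (univ.filter fun g : Fin n → Fin k × Bool => SameType f g) = univ.image Φ := by
    ext g
    simp only [mem_filter, mem_univ, true_and, mem_image, sameType_iff_exists, Prod.exists, hΦ]
  have hinj : Function.Injective Φ := by
    rintro ⟨e, σ⟩ ⟨e', σ'⟩ h
    have hpt : ∀ v, e v = e' v ∧ σ v = σ' v := by
      rintro ⟨v, hv⟩
      obtain ⟨i, -, rfl⟩ := mem_image.1 hv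
      have h1 := congrFun h i
      simpa [hΦ] using h1
    exact Prod.ext (DFunLike.ext _ _ fun v => (hpt v).1) (funext fun v => (hpt v).2)
  rw [himg, card_image_of_injective _ hinj, card_univ, Fintype.card_prod,
    Fintype.card_embedding_eq, Fintype.card_fun, Fintype.card_bool, Fintype.card_fin,
    Fintype.card_coe, numVars]

theorem sameType_toLiteral_iff {n k : ℕ} (f g : Fin n → Fin k × Bool) :
    SameType (fun i => toLiteral (f i)) (fun i => toLiteral (g i)) ↔ SameType f g := by
  simp only [SameType, toLiteral_injective.eq_iff]
  simp only [toLiteral, Fin.val_inj]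

theorem toClass_eq_iff {t t' : AndOrTree} : t.toClass = t'.toClass ↔ Equivalent t t' :=
  Quotient.eq (r := equivalentSetoid)

theorem toClass_labelled_eq_iff {n k : ℕ} {s s' : ConnTree Unit} (hs : s.size = n)
    (hs' : s'.size = n) (f f' : Fin n → Fin k × Bool) :
    (labelled s f).toClass = (labelled s' f').toClass ↔ s = s' ∧ SameType f f' := by
  rw [toClass_eq_iff]
  constructor
  · intro h
    have hst : s = s' := by
      rw [← treeStructure_labelled hs f, h.1, treeStructure_labelled hs']
    subst hst
    obtain ⟨q, -, h2, h3⟩ := exists_labelled_eq_map k hs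
    rw [h3, h3, equivalent_map_iff h2, sameType_toLiteral_iff] at h
    exact ⟨rfl, h⟩
  · rintro ⟨rfl, h⟩
    obtain ⟨q, -, h2, h3⟩ := exists_labelled_eq_map k hs
    rwa [h3, h3, equivalent_map_iff h2, sameType_toLiteral_iff]

/-- The number of classes is the sum over their members of the reciprocals of the sizes of the
classes. -/
theorem ncard_inter_classesE (n k : ℕ) {F : Set AndOrTree}
    (hF : ∀ t t', Equivalent t t' → t ∈ F → t' ∈ F) :
    ((toClass '' F ∩ classesE n k).ncard : ℝ) = familyWeight (classWeight k) n k F := by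
  classical
  set c : ConnTree Unit × (Fin n → Fin k × Bool) → AndOrClass := fun x => (labelled x.1 x.2).toClass
    with hc
  have himg : toClass '' F ∩ classesE n k = ((familyPairs n k F).image c : Finset AndOrClass) := by
    ext C
    simp only [Set.mem_inter_iff, classesE, Set.mem_image, mem_treesG_iff, coe_image, mem_coe,
      mem_familyPairs, Prod.exists, mem_structures, hc]
    constructor
    · rintro ⟨⟨t, ht, rfl⟩, t', ⟨s, hs, f, rfl⟩, h⟩
      exact ⟨s, f, ⟨hs, hF t _ (toClass_eq_iff.1 h.symm) ht⟩, h⟩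
    · rintro ⟨s, f, ⟨hs, h⟩, rfl⟩
      exact ⟨⟨_, h, rfl⟩, _, ⟨s, hs, f, rfl⟩, rfl⟩
  rw [himg, Set.ncard_coe_finset, familyWeight_eq_sum_familyPairs,
    ← sum_fiberwise_of_maps_to (g := c) fun x hx => mem_image_of_mem c hx, cast_card]
  refine sum_congr rfl fun C hC => ?_
  obtain ⟨⟨s, f⟩, hx, rfl⟩ := mem_image.1 hC
  obtain ⟨hs, hsF⟩ := mem_familyPairs.1 hx
  have hfib : (familyPairs n k F).filter (fun y => c y = c (s, f)) =
      {s} ×ˢ univ.filter fun g => SameType f g := by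
    ext ⟨s', g⟩
    simp only [mem_filter, mem_familyPairs, mem_product, mem_singleton, mem_univ, true_and, hc]
    constructor
    · rintro ⟨⟨hs', -⟩, h⟩
      obtain ⟨h1, h2⟩ := (toClass_labelled_eq_iff hs hs' f g).1 h.symm
      exact ⟨h1.symm, h2⟩
    · rintro ⟨rfl, h⟩
      have h1 := (toClass_labelled_eq_iff hs hs f g).2 ⟨rfl, h⟩
      exact ⟨⟨hs, hF _ _ (toClass_eq_iff.1 h1) hsF⟩, h1.symm⟩
  rw [hfib, sum_product, sum_singleton,
    sum_congr rfl fun g hg => by rw [SameType.numVars_eq (mem_filter.1 hg).2], sum_const,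
    card_sameType, nsmul_eq_mul, classWeight]
  have h0 : (k.descFactorial (numVars f) : ℝ) ≠ 0 := by
    rw [Nat.cast_ne_zero, ne_eq, Nat.descFactorial_eq_zero_iff_lt]
    exact (numVars_le f).not_gt
  push_cast
  exact (mul_inv_cancel₀ (by positivity)).symm

theorem muE_eq (k : ℕ → ℕ) {F : Set AndOrTree} (hF : ∀ t t', Equivalent t t' → t ∈ F → t' ∈ F)
    (n : ℕ) : muE k (toClass '' F) n = familyWeight (classWeight (k n)) n (k n) F /
      familyWeight (classWeight (k n)) n (k n) Set.univ := by
  rw [muE, ncard_inter_classesE n (k n) hF,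
    ← ncard_inter_classesE n (k n) (F := Set.univ) fun _ _ _ _ => trivial]
  congr 3
  refine (Set.inter_eq_right.2 ?_).symm
  rintro _ ⟨t, -, rfl⟩
  exact ⟨t, trivial, rfl⟩

theorem isEquivalent_muE {k : ℕ → ℕ} (hk : Tendsto k atTop atTop) :
    (muE k simpleTautologyClasses ~[atTop] fun n => (3 / 2 : ℝ) * ratE k n) ∧
      muE k tautologyClasses ~[atTop] muE k simpleTautologyClasses := by
  refine isEquivalent_of_totalWeight (w := classWeight)
    (fun _ _ => inv_nonneg.2 (by positivity)) ?_ ?_ ?_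
    (.of_forall fun n => muE_eq k (fun _ _ h => isSimpleTautology_of_equivalent h) n)
    (.of_forall fun n => muE_eq k (fun _ _ h => isTautology_of_equivalent h) n) ?_
  · filter_upwards [hk.eventually_ge_atTop 1, eventually_ge_atTop 1] with n h1 h2
    rw [totalWeight_classWeight h2]
    exact labE_pos h2 h1
  · filter_upwards [hk.eventually_ge_atTop 1, eventually_ge_atTop 2] with n h1 h2
    rw [totalWeight_classWeight (by omega)]
    exact labE_pos (by omega) h1
  · refine (tendsto_labE_div hk).congr' ?_
    filter_upwards [eventually_ge_atTop 3] with n h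
    rw [totalWeight_classWeight (by omega), totalWeight_classWeight (by omega)]
  · filter_upwards [eventually_ge_atTop 2] with n h
    rw [totalWeight_classWeight (by omega), totalWeight_classWeight (by omega), ratE]

end Labelling

theorem mainTheorem5 (k : ℕ → ℕ) (hmono : MonotoneOn k (Set.Ici 1))
    (hk : Tendsto k atTop atTop) :
    (muG k simpleTautologies ~[atTop] fun n => (3 / 2 : ℝ) * ratG k n) ∧
    (muE k simpleTautologyClasses ~[atTop] fun n => (3 / 2 : ℝ) * ratE k n) ∧
    (muG k tautologies ~[atTop] muG k simpleTautologies) ∧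
    (muE k tautologyClasses ~[atTop] muE k simpleTautologyClasses) :=
  ⟨(Labelling.isEquivalent_muG hk).1, (Labelling.isEquivalent_muE hk).1,
    (Labelling.isEquivalent_muG hk).2, (Labelling.isEquivalent_muE hk).2⟩
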